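/- **Setting.** A network is a finite connected simple graph $G=(V,E)$ with $n=|V|$ nodes that is not bipartite. Nodes are anonymous, each knows $n$, the number $\tau=\tau(G,n)$ defined below, its own degree, and a numbering of its incident edges (ports), which is arbitrary. Computation proceeds in synchronous rounds $0,1,2,\dots$: in each round every node may send at most one message through each of its ports, receives the messages sent to it in that round, and updates its state. All nodes run the same program and have independent private randomness. In the CONGEST model messages have $O(\log n)$ bits. Every node has a status in $\{\bot,\text{NON-ELECTED},\text{ELECTED}\}$, initially $\bot$. Here $\log$ is the natural logarithm. Let $\mathbf A$ be the transition matrix of the simple random walk ($a_{ij}=1/d_i$ if $ij\in E$, and $0$ otherwise), let $\pi_k=\pi_0\mathbf A^k$ (row vectors), and let $\pi_*=(d_i/(2|E|))_i$. The mixing time $\tau(G,n)$ is the least $k$ such that $\|\pi_k\mathbf A-\pi_*\|_\infty\le\frac1{2n}$ for all starting distributions $\pi_0$. **Algorithm.** Put $\rho=2\lceil\sqrt{n\log n}\,\rceil$. * *Initialization.* Each node becomes a candidate with probability $2\log n/n$ and draws a uniform rank from $\{1,\dots,n^4\}$, all independently. A candidate of rank $r$ creates $\rho$ tokens of rank $r$,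 and sets winner-so-far $=r$ and origin $=$ itself; for other nodes winner-so-far is $\bot$. * *Random walks (rounds $0,\dots,\tau$).* A node holding $k$ tokens of rank $r$ samples a port uniformly and independently $k$ times and, for every port chosen $k_x>0$ times, sends the message $\langle r,k_x\rangle$ through it. A node discards every received token whose rank is smaller than the rank of some token that it has seen so far, in the same round or before (own tokens included). The received tokens that are not discarded have the same rank and are merged, adding their counts. If their rank differs from winner-so-far, the node sets winner-so-far to this rank and origin to an arbitrary one of the ports through which tokens of this rank have just arrived. * *Notification (rounds $\tau+1,\dots,2\tau+1$).* At the end of round $\tau$, a node holding $k>0$ tokens of rank $r$ issues $k$ "winner" notifications for $r$. In each of the following rounds, all notifications for $r$ that a node has just issued or received are counted by the node if it is a candidate of rank $r$; otherwise they are forwarded as one message $\langle\mathrm{WIN},r,\mathit{cnt}\rangle$ to origin if winner-so-far $=r$, and dropped if not. * *Decision (end of round $2\tau+1$).* A candidate that has counted $\rho$ notifications becomes ELECTED; every other node becomes NON-ELECTED. **Theorem.** There are absolute constants $c>0$ and $K$ such that for every connected non-bipartite graph $G$ with $n$ nodes and mixing time $\tau=\tau(G,n)$, every port numbering and every rule for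 the arbitrary choice of origin, the following holds. 1. In every execution every message has at most $K\log n$ bits, and in all rounds $t\ge K\tau$ no message is sent and no status changes. 2. With probability at least $1-n^{-c}$, both of the following hold: whenever at least $K\tau$ rounds have been executed, exactly one node is ELECTED and all other nodes are NON-ELECTED; and the total number of messages sent during the whole execution is at most $K\,\tau\sqrt n\,\log^{3/2}n$. -/

import Mathlib

open MeasureTheory

noncomputable section

/-! ### Random walks and the mixing time -/

/-- Transition matrix of the simple random walk: `a i j = 1 / d_i` if `i ~ j`, else `0`. -/
def transitionMatrix {V : Type*} [Fintype V] (G : SimpleGraph V) [DecidableRel G.Adj] :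
    Matrix V V ℝ :=
  fun i j => if G.Adj i j then 1 / (G.degree i : ℝ) else 0

/-- Stationary distribution, with entries `d_i / (2 |E|)`. -/
def stationary {V : Type*} [Fintype V] (G : SimpleGraph V) [DecidableRel G.Adj] : V → ℝ :=
  fun i => (G.degree i : ℝ) / (2 * (G.edgeFinset.card : ℝ))

/-- Distribution `π_k` of the walk after `k` steps, started from `π₀`.  The transition matrix is
row-stochastic, so distributions are row vectors. -/
def walkDist {V : Type*} [Fintype V] [DecidableEq V] (G : SimpleGraph V) [DecidableRel G.Adj]
    (π₀ : V → ℝ) (k : ℕ) : V → ℝ :=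
  Matrix.vecMul π₀ (transitionMatrix G ^ k)

/-- The mixing time: the least `k` such that, for all starting distributions `π₀`, one further
step from `π_k` leads within `1 / (2n)` of the stationary distribution in the maximum norm
(which is the norm of `V → ℝ`). -/
def mixingTime {V : Type*} [Fintype V] [DecidableEq V] (G : SimpleGraph V) [DecidableRel G.Adj] :
    ℕ :=
  sInf {k : ℕ | ∀ π₀ ∈ stdSimplex ℝ V,
    ‖Matrix.vecMul (walkDist G π₀ k) (transitionMatrix G) - stationary G‖
      ≤ 1 / (2 * (Fintype.card V : ℝ))}

/-! ### Anonymous synchronous networks with private coins -/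

/-- The status variable of a node. -/
inductive Status where
  | undecided
  | nonElected
  | elected

/-- A port numbering: every node names its incident edges `0, …, deg - 1`. -/
abbrev PortNumbering {V : Type*} [Fintype V] (G : SimpleGraph V) [DecidableRel G.Adj] : Type _ :=
  (v : V) → Fin (G.degree v) ≃ G.neighborSet v

/-- A uniform randomized algorithm for anonymous synchronous networks.  All nodes run the same
program.  A node knows only its degree `d`, its private coins, its state and what it receives.
In every round a node sends at most one message through each of its ports, and then updates its
state from the messages received in that round. -/
structure Protocol where
  Coins : ℕ → Type
  measurableCoins : ∀ d, MeasurableSpace (Coins d)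
  law : ∀ d, Measure (Coins d)
  State : ℕ → Type
  Msg : Type
  /-- The bit string by which a message is transmitted. -/
  encode : Msg → List Bool
  encode_injective : Function.Injective encode
  init : ∀ d, Coins d → State d
  send : ∀ d, Coins d → State d → Fin d → Option Msg
  receive : ∀ d, Coins d → State d → (Fin d → Option Msg) → State d
  status : ∀ d, State d → Status

attribute [instance] Protocol.measurableCoins

namespace Protocol

variable {V : Type*} [Fintype V] {G : SimpleGraph V} [DecidableRel G.Adj]

/-- Outcomes of all private coins in the network. -/
abbrev Outcome (A : Protocol) (G : SimpleGraph V) [DecidableRel G.Adj] : Type _ :=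
  (v : V) → A.Coins (G.degree v)

/-- The coins of different nodes are independent. -/
def prob (A : Protocol) (G : SimpleGraph V) [DecidableRel G.Adj] : Measure (A.Outcome G) :=
  Measure.pi fun v => A.law (G.degree v)

/-- What node `v` finds at its port `y`, if every node `u` sends `out u x` through port `x`. -/
def deliver {M : Type} (ports : PortNumbering G) (out : (v : V) → Fin (G.degree v) → Option M)
    (v : V) (y : Fin (G.degree v)) : Option M :=
  out (ports v y) ((ports (ports v y)).symm ⟨v, (ports v y).2.symm⟩)

/-- The states of all nodes after `t` rounds (equivalently, at the start of round `t`, where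
rounds are numbered `0, 1, 2, …`). -/
def run (A : Protocol) (ports : PortNumbering G) (ω : A.Outcome G) :
    ℕ → (v : V) → A.State (G.degree v)
  | 0 => fun v => A.init _ (ω v)
  | t + 1 => fun v =>
      A.receive _ (ω v) (run A ports ω t v)
        (deliver ports (fun u x => A.send _ (ω u) (run A ports ω t u) x) v)

/-- The message (if any) that `v` sends through port `x` in round `t`. -/
def sent (A : Protocol) (ports : PortNumbering G) (ω : A.Outcome G) (t : ℕ) (v : V)
    (x : Fin (G.degree v)) : Option A.Msg :=
  A.send _ (ω v) (A.run ports ω t v) x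

/-- Number of messages sent in the whole network during the first `t` rounds. -/
def messages (A : Protocol) (ports : PortNumbering G) (ω : A.Outcome G) (t : ℕ) : ℕ :=
  ∑ s ∈ Finset.range t, ∑ v : V,
    (Finset.univ.filter fun x => (A.sent ports ω s v x).isSome = true).card

/-- After `t` rounds exactly one node is elected and all other nodes are non-elected. -/
def LeaderAt (A : Protocol) (ports : PortNumbering G) (ω : A.Outcome G) (t : ℕ) : Prop :=
  ∃ l : V, A.status _ (A.run ports ω t l) = Status.elected ∧
    ∀ v : V, v ≠ l → A.status _ (A.run ports ω t v) = Status.nonElected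

/-- In every execution every message has at most `B` bits.  (That at most one message per round
crosses an edge in each direction is built into `Protocol`.) -/
def MessageSizeLE (A : Protocol) (ports : PortNumbering G) (B : ℝ) : Prop :=
  ∀ (ω : A.Outcome G) (t : ℕ) (v : V) (x : Fin (G.degree v)) (m : A.Msg),
    A.sent ports ω t v x = some m → ((A.encode m).length : ℝ) ≤ B

/-- In every execution, no message is sent and no status changes in the rounds `t ≥ B`. -/
def HaltsWithin (A : Protocol) (ports : PortNumbering G) (B : ℝ) : Prop :=
  ∀ (ω : A.Outcome G) (t : ℕ), B ≤ (t : ℝ) → ∀ v : V,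
    (∀ x, A.sent ports ω t v x = none) ∧
      A.status _ (A.run ports ω (t + 1) v) = A.status _ (A.run ports ω t v)

end Protocol

/-! ### The random-walk leader election algorithm

`n` is the number of nodes and `T` the mixing time, both known to the nodes. -/

namespace Election

/-- The ranks `1, …, n ^ 4`. -/
abbrev Rank (n : ℕ) : Type := Set.Icc 1 (n ^ 4)

/-- `2 ⌈√(n log n)⌉`, the number of tokens (competitions) of a candidate. -/
def numTokens (n : ℕ) : ℕ := 2 * ⌈Real.sqrt ((n : ℝ) * Real.log n)⌉₊

/-- `token r k` stands for `k` random walks of the candidate of rank `r`;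
`win r k` stands for `k` winner notifications for rank `r`. -/
inductive Msg (n : ℕ) where
  | token (r : Rank n) (k : ℕ)
  | win (r : Rank n) (k : ℕ)

/-- Injective numbering of the messages, transmitted in binary. -/
def Msg.code {n : ℕ} : Msg n → ℕ
  | .token r k => 2 * Nat.pair r.1 k
  | .win r k => 2 * Nat.pair r.1 k + 1

theorem Msg.code_injective {n : ℕ} : Function.Injective (Msg.code (n := n)) := by
  rintro (⟨r, k⟩ | ⟨r, k⟩) (⟨r', k'⟩ | ⟨r', k'⟩) h <;> simp only [Msg.code] at h
  · have := Nat.pair_eq_pair.1 (by omega : Nat.pair r.1 k = Nat.pair r'.1 k')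
    rw [Subtype.ext this.1, this.2]
  · omega
  · omega
  · have := Nat.pair_eq_pair.1 (by omega : Nat.pair r.1 k = Nat.pair r'.1 k')
    rw [Subtype.ext this.1, this.2]

theorem bits_injective : Function.Injective Nat.bits := by
  intro a
  induction a using Nat.binaryRec' with
  | zero =>
    intro b h
    induction b using Nat.binaryRec' with
    | zero => rfl
    | bit c m hm _ => rw [Nat.bits_append_bit m c hm] at h; simp at h
  | bit b a ha ih =>
    intro b' h
    induction b' using Nat.binaryRec' with
    | zero => rw [Nat.bits_append_bit a b ha] at h; simp at h
    | bit c m hm _ =>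
      rw [Nat.bits_append_bit a b ha, Nat.bits_append_bit m c hm] at h
      obtain ⟨h1, h2⟩ := List.cons.inj h
      rw [h1, ih h2]

/-- Rank of a received token (`⊥` if there is none). -/
def tokenRank {n : ℕ} : Option (Msg n) → WithBot (Rank n)
  | some (.token r _) => (r : WithBot (Rank n))
  | _ => ⊥

/-- Number of walks represented by a received token. -/
def tokenCount {n : ℕ} : Option (Msg n) → ℕ
  | some (.token _ k) => k
  | _ => 0

/-- Rank of a received winner notification (`⊥` if there is none). -/
def winRank {n : ℕ} : Option (Msg n) → WithBot (Rank n)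
  | some (.win r _) => (r : WithBot (Rank n))
  | _ => ⊥

/-- Number of winner notifications represented by a received message. -/
def winCount {n : ℕ} : Option (Msg n) → ℕ
  | some (.win _ k) => k
  | _ => 0

/-- Private coins of a node of degree `d`: whether it is a candidate, its rank, and for each
round `0, …, T` and each rank a supply of random ports.  At most `n * numTokens n` tokens
exist in the network, so the supply is never exhausted. -/
abbrev Coins (n T d : ℕ) : Type :=
  Bool × Rank n × (Fin (T + 1) × Rank n × Fin (n * numTokens n) → Fin d)

/-- Distribution of `true` with probability `2 log n / n`, which is at most `1`. -/
def candidateLaw (n : ℕ) : Measure Bool :=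
  ENNReal.ofReal (2 * Real.log n / n) • Measure.dirac true +
    ENNReal.ofReal (1 - 2 * Real.log n / n) • Measure.dirac false

/-- Candidacy, rank and all the ports are independent; rank and ports are uniform. -/
def coinLaw (n T d : ℕ) : Measure (Coins n T d) :=
  (candidateLaw n).prod
    ((ProbabilityTheory.uniformOn (Set.univ : Set (Rank n))).prod
      (Measure.pi fun _ => ProbabilityTheory.uniformOn (Set.univ : Set (Fin d))))

/-- State of a node of degree `d`. -/
structure State (n d : ℕ) where
  /-- number of rounds executed -/
  clock : ℕ
  /-- own rank, `⊥` if the node is not a candidate -/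
  own : WithBot (Rank n)
  /-- winner-so-far: the largest rank among all tokens seen, own tokens included -/
  best : WithBot (Rank n)
  /-- port from which rank `best` was first received; `none` is the node itself -/
  origin : Option (Fin d)
  /-- number of tokens of rank `best` held by the node -/
  held : ℕ
  /-- number of winner notifications for `best` still to be forwarded to `origin` -/
  pending : ℕ
  /-- number of winner notifications received for the own rank -/
  wins : ℕ
  status : Status

/-- A candidate starts with `numTokens n` tokens of its own rank. -/
def init (n T d : ℕ) (ω : Coins n T d) : State n d where
  clock := 0
  own := if ω.1 then (ω.2.1 : WithBot (Rank n)) else ⊥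
  best := if ω.1 then (ω.2.1 : WithBot (Rank n)) else ⊥
  origin := none
  held := if ω.1 then numTokens n else 0
  pending := 0
  wins := 0
  status := Status.undecided

/-- If `k` tokens of rank `r` are forwarded in round `t`, by `k` samples of a port, this is the
number of times that port `x` is chosen. -/
def sampleCount {n T d : ℕ} (ω : Coins n T d) (t : Fin (T + 1)) (r : Rank n) (k : ℕ)
    (x : Fin d) : ℕ :=
  (Finset.univ.filter fun j : Fin (n * numTokens n) => j.1 < k ∧ ω.2.2 (t, r, j) = x).card

/-- Rounds `0, …, T`: forward the held tokens, sending only their counts.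
Rounds `T + 1, …, 2 T + 1`: forward the pending winner notifications to `origin`.
Afterwards the node is silent. -/
def send (n T d : ℕ) (ω : Coins n T d) (s : State n d) (x : Fin d) : Option (Msg n) :=
  match s.best with
  | ⊥ => none
  | (r : Rank n) =>
    if h : s.clock < T + 1 then
      let k := sampleCount ω ⟨s.clock, h⟩ r s.held x
      if 0 < k then some (.token r k) else none
    else if s.clock < 2 * (T + 1) ∧ 0 < s.pending ∧ s.origin = some x then
      some (.win r s.pending)
    else none

/-- A rule for choosing one among several ports that brought the new winner-so-far. -/
abbrev PortChoice : Type := (d : ℕ) → (s : Finset (Fin d)) → s.Nonempty → {x : Fin d // x ∈ s}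

/-- Reception in rounds `0, …, T`: tokens of rank below the largest rank ever seen are discarded,
those of the largest rank are merged.  At the end of round `T` the walks are over: the node issues
one winner notification per token that it holds. -/
def receiveToken {n d : ℕ} (T : ℕ) (pick : PortChoice) (s : State n d)
    (inbox : Fin d → Option (Msg n)) : State n d :=
  let best' := s.best ⊔ Finset.univ.sup fun x => tokenRank (inbox x)
  let from' := Finset.univ.filter fun x => tokenRank (inbox x) = best'
  let held' := ∑ x, if tokenRank (inbox x) = best' then tokenCount (inbox x) else 0
  { s with
    clock := s.clock + 1
    best := best'
    origin := if h : best' ≠ s.best ∧ from'.Nonempty then some (pick d from' h.2).1 else s.origin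
    held := held'
    pending := if s.clock = T ∧ s.own ≠ best' then held' else 0
    wins := if s.clock = T ∧ s.own = best' then held' else 0 }

/-- Reception in rounds `T + 1, …, 2 T + 1`: notifications for the own rank are counted, those for
the winner-so-far are merged, to be forwarded, all others are dropped.  The status is set at the
end of round `2 T + 1`. -/
def receiveWin {n d : ℕ} (T : ℕ) (s : State n d) (inbox : Fin d → Option (Msg n)) : State n d :=
  let wins' := s.wins + ∑ x, if winRank (inbox x) = s.own then winCount (inbox x) else 0
  { s with
    clock := s.clock + 1
    pending := ∑ x, if winRank (inbox x) = s.best ∧ winRank (inbox x) ≠ s.own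
      then winCount (inbox x) else 0
    wins := wins'
    status :=
      if s.clock = 2 * T + 1 then
        if s.own ≠ ⊥ ∧ wins' = numTokens n then Status.elected else Status.nonElected
      else s.status }

/-- State update at the end of a round. -/
def receive (n T d : ℕ) (pick : PortChoice) (s : State n d) (inbox : Fin d → Option (Msg n)) :
    State n d :=
  if s.clock < T + 1 then receiveToken T pick s inbox
  else if s.clock < 2 * (T + 1) then receiveWin T s inbox
  else s

/-- The leader election algorithm with parameters `n` (number of nodes) and `T` (mixing time). -/
def algorithm (n T : ℕ) (pick : PortChoice) : Protocol where
  Coins := Coins n T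
  measurableCoins := fun _ => inferInstance
  law := coinLaw n T
  State := State n
  Msg := Msg n
  encode := fun m => Nat.bits m.code
  encode_injective := bits_injective.comp Msg.code_injective
  init := init n T
  send := send n T
  receive := fun d _ s inbox => receive n T d pick s inbox
  status := fun _ s => s.status

/-- The algorithm on the network `G`, with its true size and mixing time as parameters. -/
def algorithmOn {V : Type*} [Fintype V] [DecidableEq V] (G : SimpleGraph V) [DecidableRel G.Adj]
    (pick : PortChoice) : Protocol :=
  algorithm (Fintype.card V) (mixingTime G) pick

end Election

end

/-!
Follow the walks that the candidates' tokens would make if nothing were ever discarded. The walks of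
the largest rank are unaffected by the others, so every notification of that rank finds its way back
along the `origin` pointers and the corresponding candidate counts all `ρ` of them. A candidate of
smaller rank is not elected as soon as one of its walks is at the same node in the last round as a
walk of a larger rank, since it then loses a token.

For two ranks, the `ρ` walks of one and the `ρ` walks of the other end at independent points whose
laws are within `1 / (2n)` of the stationary one, so by a birthday argument with `ρ ≥ 2 √(n log n)`
they miss each other with probability at most `n ^ (-1/4)`. A union bound over pairs of nodes, with
the expected number of candidates `2 log n` and the probability that two ranks coincide, settles all
large `n`. For the finitely many small `n` it is enough that exactly one candidate appears with
positive probability, because the exponent `c` may be taken small.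
-/

open Filter
open scoped Matrix

/-! ### Convergence of the simple random walk -/

section Stochastic

variable {ι : Type*} [Fintype ι] [DecidableEq ι] {P : Matrix ι ι ℝ}

theorem sum_vecMul_of_mem_rowStochastic (hP : P ∈ Matrix.rowStochastic ℝ ι) (x : ι → ℝ) :
    ∑ j, (x ᵥ* P) j = ∑ i, x i := by
  simp only [Matrix.vecMul, dotProduct]
  rw [Finset.sum_comm]
  simp only [← Finset.mul_sum, Matrix.sum_row_of_mem_rowStochastic hP, mul_one]

-- A multiple of the all-ones matrix annihilates `x`, so `δ` may be subtracted from all entries.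
theorem sum_abs_vecMul_le (hP : P ∈ Matrix.rowStochastic ℝ ι) {δ : ℝ} (hδ : ∀ i j, δ ≤ P i j)
    {x : ι → ℝ} (hx : ∑ i, x i = 0) :
    ∑ j, |(x ᵥ* P) j| ≤ (1 - Fintype.card ι * δ) * ∑ i, |x i| := by
  have hsub (j : ι) : (x ᵥ* P) j = ∑ i, x i * (P i j - δ) := by
    simp only [mul_sub, Finset.sum_sub_distrib, ← Finset.sum_mul, hx, zero_mul, sub_zero,
      Matrix.vecMul, dotProduct]
  calc ∑ j, |(x ᵥ* P) j| ≤ ∑ j, ∑ i, |x i| * (P i j - δ) := by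
        refine Finset.sum_le_sum fun j _ => ?_
        rw [hsub]
        refine (Finset.abs_sum_le_sum_abs _ _).trans_eq (Finset.sum_congr rfl fun i _ => ?_)
        rw [abs_mul, abs_of_nonneg (sub_nonneg.2 (hδ i j))]
    _ = (1 - Fintype.card ι * δ) * ∑ i, |x i| := by
        rw [Finset.sum_comm, Finset.mul_sum]
        refine Finset.sum_congr rfl fun i _ => ?_
        rw [← Finset.mul_sum, Finset.sum_sub_distrib, Matrix.sum_row_of_mem_rowStochastic hP,
          Finset.sum_const, Finset.card_univ, nsmul_eq_mul, mul_comm]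

theorem sum_abs_vecMul_pow_le (hP : P ∈ Matrix.rowStochastic ℝ ι) {δ : ℝ}
    (hδ : ∀ i j, δ ≤ P i j) (hδ1 : Fintype.card ι * δ ≤ 1) {x : ι → ℝ} (hx : ∑ i, x i = 0)
    (m : ℕ) : ∑ j, |(x ᵥ* P ^ m) j| ≤ (1 - Fintype.card ι * δ) ^ m * ∑ i, |x i| := by
  induction m with
  | zero => simp
  | succ m ih =>
    rw [pow_succ, ← Matrix.vecMul_vecMul, pow_succ', mul_assoc]
    refine (sum_abs_vecMul_le hP hδ ?_).trans
      (mul_le_mul_of_nonneg_left ih (sub_nonneg.2 hδ1))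
    rw [sum_vecMul_of_mem_rowStochastic (pow_mem hP m), hx]

theorem exists_sum_abs_vecMul_pow_le [Nonempty ι] (hP : P ∈ Matrix.rowStochastic ℝ ι)
    (hpos : ∀ i j, 0 < P i j) {ε : ℝ} (hε : 0 < ε) :
    ∃ m, ∀ x : ι → ℝ, ∑ i, x i = 0 → ∑ j, |(x ᵥ* P ^ m) j| ≤ ε * ∑ i, |x i| := by
  obtain ⟨p, hp⟩ := Finite.exists_min fun p : ι × ι => P p.1 p.2
  have hδ (i j : ι) : P p.1 p.2 ≤ P i j := hp (i, j)
  have hδ1 : Fintype.card ι * P p.1 p.2 ≤ 1 := by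
    rw [← Matrix.sum_row_of_mem_rowStochastic hP p.1, ← nsmul_eq_mul]
    exact Finset.card_nsmul_le_sum _ _ _ fun j _ => hδ p.1 j
  have hδ0 : 1 - Fintype.card ι * P p.1 p.2 < 1 :=
    sub_lt_self _ (mul_pos (Nat.cast_pos.2 Fintype.card_pos) (hpos _ _))
  obtain ⟨m, hm⟩ := exists_pow_lt_of_lt_one hε hδ0
  refine ⟨m, fun x hx => (sum_abs_vecMul_pow_le hP hδ hδ1 hx m).trans ?_⟩
  gcongr

theorem exists_sum_abs_vecMul_pow_sub_le (hP : P ∈ Matrix.rowStochastic ℝ ι) (hprim : P.IsPrimitive)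
    {π : ι → ℝ} (hπ : π ∈ stdSimplex ℝ ι) (hstat : π ᵥ* P = π) {ε : ℝ} (hε : 0 < ε) :
    ∃ k : ℕ, ∀ π₀ ∈ stdSimplex ℝ ι, ∑ j, |(π₀ ᵥ* P ^ (k + 1) - π) j| ≤ ε := by
  have : Nonempty ι := not_isEmpty_iff.1 fun _ => by simpa using hπ.2
  obtain ⟨N, -, hpos⟩ := hprim.exists_pos_pow
  obtain ⟨m, hm⟩ := exists_sum_abs_vecMul_pow_le (pow_mem hP N) hpos (half_pos hε)
  have hfix (k : ℕ) : π ᵥ* P ^ k = π := by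
    induction k with
    | zero => simp
    | succ k ih => rw [pow_succ, ← Matrix.vecMul_vecMul, ih, hstat]
  have hdiff {π₀ : ι → ℝ} (hπ₀ : π₀ ∈ stdSimplex ℝ ι) : ∑ i, |(π₀ - π) i| ≤ 2 :=
    calc ∑ i, |(π₀ - π) i| ≤ ∑ i, (π₀ i + π i) := Finset.sum_le_sum fun i _ => by
          rw [Pi.sub_apply, abs_le]
          constructor <;> linarith [hπ₀.1 i, hπ.1 i]
      _ = 2 := by rw [Finset.sum_add_distrib, hπ₀.2, hπ.2]; norm_num
  -- One extra application of `P` keeps the `ℓ¹` norm from growing and makes the exponent positive.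
  refine ⟨N * m, fun π₀ hπ₀ => ?_⟩
  have hzero : ∑ i, (π₀ - π) i = 0 := by simp [hπ₀.2, hπ.2]
  calc ∑ j, |(π₀ ᵥ* P ^ (N * m + 1) - π) j|
      = ∑ j, |((π₀ - π) ᵥ* (P ^ N) ^ m ᵥ* P) j| := by
        rw [Matrix.vecMul_vecMul, ← pow_mul, ← pow_succ, Matrix.sub_vecMul, hfix]
    _ ≤ ∑ j, |((π₀ - π) ᵥ* (P ^ N) ^ m) j| := by
        refine (sum_abs_vecMul_le hP (δ := 0) hprim.nonneg ?_).trans_eq (by simp)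
        rw [sum_vecMul_of_mem_rowStochastic (pow_mem (pow_mem hP N) m), hzero]
    _ ≤ ε / 2 * ∑ i, |(π₀ - π) i| := hm _ hzero
    _ ≤ ε := by linarith [mul_le_mul_of_nonneg_left (hdiff hπ₀) (half_pos hε).le]

end Stochastic

section RandomWalk

variable {V : Type*} {G : SimpleGraph V}

theorem exists_walk_length_add_two_mul {u w x : V} (hx : G.Adj w x) (p : G.Walk u w) (m : ℕ) :
    ∃ p' : G.Walk u w, p'.length = p.length + 2 * m := by
  induction m with
  | zero => exact ⟨p, rfl⟩
  | succ m ih =>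
    obtain ⟨p', hp'⟩ := ih
    refine ⟨p'.append (.cons hx (.cons hx.symm .nil)), ?_⟩
    simp only [SimpleGraph.Walk.length_append, SimpleGraph.Walk.length_cons,
      SimpleGraph.Walk.length_nil, hp']
    ring

-- A detour along an odd closed walk changes the parity of the length.
theorem eventually_exists_walk_length_eq (hc : G.Preconnected) (hb : ¬ G.IsBipartite) (u w : V) :
    ∀ᶠ k in atTop, ∃ p : G.Walk u w, p.length = k := by
  obtain ⟨z, q, hq⟩ : ∃ z, ∃ q : G.Walk z z, Odd q.length := by
    by_contra! h
    exact hb (SimpleGraph.two_colorable_iff_forall_loop_even.2 fun z q =>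
      Nat.not_odd_iff_even.1 (h z q))
  obtain ⟨x, hx⟩ : ∃ x, G.Adj z x := by
    cases q with
    | nil => simp at hq
    | cons hx _ => exact ⟨_, hx⟩
  obtain ⟨p₁⟩ := hc u z
  obtain ⟨p₂⟩ := hc z w
  filter_upwards [eventually_ge_atTop (p₁.length + q.length + p₂.length)] with k hk
  rcases Nat.even_or_odd' (k - (p₁.length + q.length + p₂.length)) with ⟨m, hm | hm⟩
  · obtain ⟨p, hp⟩ := exists_walk_length_add_two_mul hx (p₁.append q) m
    refine ⟨p.append p₂, ?_⟩
    simp only [SimpleGraph.Walk.length_append] at hp ⊢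
    omega
  · obtain ⟨a, ha⟩ := hq
    obtain ⟨p, hp⟩ := exists_walk_length_add_two_mul hx p₁ (m + a + 1)
    refine ⟨p.append p₂, ?_⟩
    simp only [SimpleGraph.Walk.length_append]
    omega

variable [Fintype V]

theorem three_le_card_of_not_isBipartite (hb : ¬ G.IsBipartite) : 3 ≤ Fintype.card V := by
  by_contra h
  exact hb (G.colorable_of_fintype.mono (by omega))

variable [DecidableRel G.Adj]

theorem degree_pos_of_not_isBipartite (hc : G.Connected) (hb : ¬ G.IsBipartite) (v : V) :
    0 < G.degree v := by
  have := three_le_card_of_not_isBipartite hb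
  have : Nontrivial V := Fintype.one_lt_card_iff_nontrivial.1 (by omega)
  exact hc.preconnected.degree_pos_of_nontrivial v

theorem transitionMatrix_nonneg (i j : V) : 0 ≤ transitionMatrix G i j := by
  unfold transitionMatrix; split_ifs <;> positivity

theorem transitionMatrix_pos {i j : V} (h : G.Adj i j) : 0 < transitionMatrix G i j := by
  have : 0 < G.degree i := (G.degree_pos_iff_exists_adj i).2 ⟨j, h⟩
  rw [transitionMatrix, if_pos h]
  positivity

theorem stationary_mem_stdSimplex (h : ∀ v, 0 < G.degree v) [Nonempty V] :
    stationary G ∈ stdSimplex ℝ V := by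
  have hpos : 0 < ∑ v, G.degree v := Finset.sum_pos (fun v _ => h v) Finset.univ_nonempty
  refine ⟨fun v => by unfold stationary; positivity, ?_⟩
  simp only [stationary]
  rw [← Finset.sum_div, ← Nat.cast_sum, ← Nat.cast_ofNat, ← Nat.cast_mul,
    ← SimpleGraph.sum_degrees_eq_twice_card_edges, div_self (Nat.cast_ne_zero.2 hpos.ne')]

-- Detailed balance: the probability flow from `i` to `j` is `1 / (2 |E|)` in both directions.
theorem stationary_vecMul (h : ∀ v, 0 < G.degree v) :
    stationary G ᵥ* transitionMatrix G = stationary G := by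
  have hflow (i j : V) : stationary G i * transitionMatrix G i j =
      (if G.Adj j i then 1 else 0) / (2 * (G.edgeFinset.card : ℝ)) := by
    have := (Nat.cast_pos (α := ℝ)).2 (h i)
    by_cases hij : G.Adj i j
    · rw [stationary, transitionMatrix, if_pos hij, if_pos hij.symm]
      field_simp
    · rw [stationary, transitionMatrix, if_neg hij, if_neg fun h => hij h.symm, mul_zero, zero_div]
  funext j
  simp only [Matrix.vecMul, dotProduct, hflow]
  rw [← Finset.sum_div, Finset.sum_boole, ← SimpleGraph.neighborFinset_eq_filter,
    SimpleGraph.card_neighborFinset_eq_degree, stationary]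

variable [DecidableEq V]

theorem transitionMatrix_mem_rowStochastic (h : ∀ v, 0 < G.degree v) :
    transitionMatrix G ∈ Matrix.rowStochastic ℝ V := by
  refine Matrix.mem_rowStochastic_iff_sum.2 ⟨transitionMatrix_nonneg, fun i => ?_⟩
  have hi : (G.degree i : ℝ) ≠ 0 := Nat.cast_ne_zero.2 (h i).ne'
  simp only [transitionMatrix]
  rw [← Finset.sum_filter, Finset.sum_const, ← SimpleGraph.neighborFinset_eq_filter,
    SimpleGraph.card_neighborFinset_eq_degree, nsmul_eq_mul, mul_one_div_cancel hi]

theorem transitionMatrix_pow_pos_of_walk (h : ∀ v, 0 < G.degree v) {u w : V} (p : G.Walk u w) :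
    0 < (transitionMatrix G ^ p.length) u w := by
  induction p with
  | nil => simp
  | @cons a b c hab p ih =>
    rw [SimpleGraph.Walk.length_cons, pow_succ', Matrix.mul_apply]
    have hnonneg (l : V) : 0 ≤ (transitionMatrix G ^ p.length) l c :=
      Matrix.nonneg_of_mem_rowStochastic (pow_mem (transitionMatrix_mem_rowStochastic h) _)
    exact Finset.sum_pos' (fun l _ => mul_nonneg (transitionMatrix_nonneg _ _) (hnonneg l))
      ⟨b, Finset.mem_univ _, mul_pos (transitionMatrix_pos hab) ih⟩

theorem isPrimitive_transitionMatrix (hc : G.Connected) (hb : ¬ G.IsBipartite) :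
    (transitionMatrix G).IsPrimitive := by
  refine ⟨transitionMatrix_nonneg, ?_⟩
  have hwalk : ∀ᶠ k in atTop, ∀ u w, ∃ p : G.Walk u w, p.length = k :=
    eventually_all.2 fun u => eventually_all.2 fun w =>
      eventually_exists_walk_length_eq hc.preconnected hb u w
  obtain ⟨k, hk, h⟩ := ((eventually_gt_atTop 0).and hwalk).exists
  refine ⟨k, hk, fun u w => ?_⟩
  obtain ⟨p, rfl⟩ := h u w
  exact transitionMatrix_pow_pos_of_walk (degree_pos_of_not_isBipartite hc hb) p

theorem norm_walkDist_mixingTime_sub_stationary_le (hc : G.Connected) (hb : ¬ G.IsBipartite)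
    {π₀ : V → ℝ} (hπ₀ : π₀ ∈ stdSimplex ℝ V) :
    ‖walkDist G π₀ (mixingTime G) ᵥ* transitionMatrix G - stationary G‖
      ≤ 1 / (2 * (Fintype.card V : ℝ)) := by
  have := hc.nonempty
  have hdeg := degree_pos_of_not_isBipartite hc hb
  have hε : 0 < 1 / (2 * (Fintype.card V : ℝ)) := by positivity
  obtain ⟨k, hk⟩ := exists_sum_abs_vecMul_pow_sub_le (transitionMatrix_mem_rowStochastic hdeg)
    (isPrimitive_transitionMatrix hc hb) (stationary_mem_stdSimplex hdeg)
    (stationary_vecMul hdeg) hε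
  have hmem : {k : ℕ | ∀ π₀ ∈ stdSimplex ℝ V,
      ‖walkDist G π₀ k ᵥ* transitionMatrix G - stationary G‖
        ≤ 1 / (2 * (Fintype.card V : ℝ))}.Nonempty := by
    refine ⟨k, fun π hπ => (pi_norm_le_iff_of_nonneg hε.le).2 fun j => ?_⟩
    rw [walkDist, Matrix.vecMul_vecMul, ← pow_succ]
    exact (Finset.single_le_sum
      (f := fun j => |(π ᵥ* transitionMatrix G ^ (k + 1) - stationary G) j|)
      (fun _ _ => abs_nonneg _) (Finset.mem_univ j)).trans (hk π hπ)
  exact Nat.sInf_mem hmem π₀ hπ₀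

theorem abs_transitionMatrix_pow_sub_stationary_le (hc : G.Connected) (hb : ¬ G.IsBipartite)
    (u w : V) : |(transitionMatrix G ^ (mixingTime G + 1)) u w - stationary G w|
      ≤ 1 / (2 * (Fintype.card V : ℝ)) := by
  have h := (norm_le_pi_norm _ w).trans
    (norm_walkDist_mixingTime_sub_stationary_le hc hb (single_mem_stdSimplex ℝ u))
  rwa [walkDist, Matrix.vecMul_vecMul, ← pow_succ, Matrix.single_one_vecMul] at h

-- If `mixingTime G = 0`, then `|0 - stationary G v| ≤ 1 / (2n)` because a step leaves `v`; summing
-- over `v` contradicts `∑ v, stationary G v = 1`.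
theorem mixingTime_pos (hc : G.Connected) (hb : ¬ G.IsBipartite) : 0 < mixingTime G := by
  have := hc.nonempty
  have : (0 : ℝ) < Fintype.card V := Nat.cast_pos.2 Fintype.card_pos
  refine Nat.pos_of_ne_zero fun h0 => ?_
  have hle (v : V) : stationary G v ≤ 1 / (2 * (Fintype.card V : ℝ)) := by
    have h := abs_transitionMatrix_pow_sub_stationary_le hc hb v v
    rw [h0, zero_add, pow_one, transitionMatrix, if_neg (G.loopless.irrefl v), zero_sub,
      abs_neg] at h
    exact (le_abs_self _).trans h
  have hsum := Finset.sum_le_card_nsmul Finset.univ _ _ fun v _ => hle v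
  rw [(stationary_mem_stdSimplex (degree_pos_of_not_isBipartite hc hb)).2, Finset.card_univ,
    nsmul_eq_mul] at hsum
  field_simp at hsum
  norm_num at hsum

end RandomWalk

namespace Election

/-! ### Ports and the reversal of edges -/

section Ports

variable {V : Type*} [Fintype V] {G : SimpleGraph V} [DecidableRel G.Adj]

/-- The port number, at the other end, of the edge at port `y` of `v`. -/
def backPort (ports : PortNumbering G) (v : V) (y : Fin (G.degree v)) :
    Fin (G.degree (ports v y : V)) :=
  (ports (ports v y)).symm ⟨v, (ports v y).2.symm⟩

theorem ports_backPort (ports : PortNumbering G) (v : V) (y : Fin (G.degree v)) :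
    (ports (ports v y) (backPort ports v y) : V) = v := by
  simp [backPort]

/-- Reversal of edges, as a permutation of the pairs of a node and one of its ports. -/
def reversePort (ports : PortNumbering G) :
    (Σ v : V, Fin (G.degree v)) ≃ (Σ v : V, Fin (G.degree v)) :=
  (Equiv.sigmaCongrRight ports).trans
    ((⟨fun p => ⟨p.2.1, p.1, p.2.2.symm⟩, fun p => ⟨p.2.1, p.1, p.2.2.symm⟩,
        fun _ => rfl, fun _ => rfl⟩ :
      (Σ v : V, G.neighborSet v) ≃ (Σ v : V, G.neighborSet v)).trans
    (Equiv.sigmaCongrRight ports).symm)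

@[to_additive]
theorem prod_reversePort {M : Type*} [CommMonoid M] (ports : PortNumbering G)
    (F : V → (u : V) → Fin (G.degree u) → M) :
    ∏ v, ∏ y, F v (ports v y) (backPort ports v y) = ∏ u, ∏ x, F (ports u x) u x := by
  rw [← Fintype.prod_sigma', ← Fintype.prod_sigma', ← Equiv.prod_comp (reversePort ports)
    fun p => F (ports p.1 p.2) p.1 p.2]
  refine Finset.prod_congr rfl fun p _ => ?_
  change _ = F (ports (ports p.1 p.2) (backPort ports p.1 p.2)) _ _
  rw [ports_backPort]
  rfl

end Ports

/-! ### Sampling of ports -/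

section Sampling

variable {n T d : ℕ} (c : Coins n T d) (t : Fin (T + 1)) (r : Rank n)

theorem sampleCount_mono {k l : ℕ} (h : k ≤ l) (x : Fin d) :
    sampleCount c t r k x ≤ sampleCount c t r l x :=
  Finset.card_le_card (Finset.monotone_filter_right _ fun _ _ hj => ⟨hj.1.trans_le h, hj.2⟩)

theorem sum_sampleCount (k : ℕ) : ∑ x, sampleCount c t r k x = min (n * numTokens n) k := by
  rw [← Fin.card_filter_val_lt, Finset.card_eq_sum_card_fiberwise
    (f := fun j => c.2.2 (t, r, j)) (t := Finset.univ)
    fun _ _ => Finset.mem_coe.2 (Finset.mem_univ _)]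
  simp only [sampleCount, Finset.filter_filter]

end Sampling

/-! ### Undisturbed random walks -/

/-- Outcomes of all private coins of the algorithm with parameters `n` and `T`. -/
abbrev Outcomes {V : Type*} [Fintype V] (G : SimpleGraph V) [DecidableRel G.Adj] (n T : ℕ) :
    Type _ :=
  (v : V) → Coins n T (G.degree v)

section WalkCount

variable {V : Type*} [Fintype V] [DecidableEq V] {G : SimpleGraph V} [DecidableRel G.Adj]
  (ports : PortNumbering G) {n T : ℕ}

/-- Numbers of tokens at all nodes after `t` rounds, if `u` starts with `numTokens n` tokens, which
use the coins for rank `r` and are never discarded. -/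
noncomputable def walkCount (ω : Outcomes G n T) (r : Rank n) (u : V) : ℕ → V → ℕ
  | 0 => Pi.single u (numTokens n)
  | t + 1 => fun v =>
      if h : t < T + 1 then
        ∑ y, sampleCount (ω (ports v y)) ⟨t, h⟩ r (walkCount ω r u t (ports v y))
          (backPort ports v y)
      else 0

variable (ω : Outcomes G n T) (r : Rank n) (u : V)

theorem walkCount_succ {t : ℕ} (h : t < T + 1) (v : V) :
    walkCount ports ω r u (t + 1) v =
      ∑ y, sampleCount (ω (ports v y)) ⟨t, h⟩ r (walkCount ports ω r u t (ports v y))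
          (backPort ports v y) :=
  dif_pos h

theorem sum_walkCount (hn : 0 < n) {t : ℕ} (ht : t ≤ T + 1) :
    ∑ v, walkCount ports ω r u t v = numTokens n := by
  induction t with
  | zero => exact Finset.sum_pi_single' u _ _ |>.trans (if_pos (Finset.mem_univ u))
  | succ t ih =>
    have hsum := ih (by omega)
    have hle (v : V) : walkCount ports ω r u t v ≤ n * numTokens n :=
      (Finset.single_le_sum (fun _ _ => Nat.zero_le _) (Finset.mem_univ v)).trans
        (hsum.trans_le (Nat.le_mul_of_pos_left _ hn))
    simp only [walkCount_succ ports ω r u (show t < T + 1 by omega)]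
    rw [sum_reversePort ports fun _ w x =>
      sampleCount (ω w) ⟨t, by omega⟩ r (walkCount ports ω r u t w) x]
    simp only [sum_sampleCount, min_eq_right (hle _), hsum]

theorem walkCount_le (hn : 0 < n) {t : ℕ} (ht : t ≤ T + 1) (v : V) :
    walkCount ports ω r u t v ≤ n * numTokens n :=
  (Finset.single_le_sum (fun _ _ => Nat.zero_le _) (Finset.mem_univ v)).trans
    ((sum_walkCount ports ω r u hn ht).trans_le (Nat.le_mul_of_pos_left _ hn))

theorem walkCount_congr {ω ω' : Outcomes G n T} {t : ℕ}
    (h : ∀ v (s : Fin (T + 1)), s.1 < t → ∀ j, (ω v).2.2 (s, r, j) = (ω' v).2.2 (s, r, j)) :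
    walkCount ports ω r u t = walkCount ports ω' r u t := by
  induction t with
  | zero => rfl
  | succ t ih =>
    have ih := ih fun v s hs => h v s (by omega)
    funext v
    by_cases ht : t < T + 1
    · simp only [walkCount_succ _ _ _ _ ht, ih, sampleCount,
        h (ports v _) ⟨t, ht⟩ (Nat.lt_succ_self t)]
    · simp only [walkCount, dif_neg ht]

end WalkCount

/-! ### The messages sent by a node -/

section Send

variable {n T d : ℕ}

/-- Number of tokens of rank `r` in a message. -/
def tokensOf (r : Rank n) (m : Option (Msg n)) : ℕ :=
  if tokenRank m = r then tokenCount m else 0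

/-- Number of notifications for rank `r` in a message. -/
def winsOf (r : Rank n) (m : Option (Msg n)) : ℕ :=
  if winRank m = r then winCount m else 0

/-- Number of tokens or notifications in a message. -/
def msgCount (m : Option (Msg n)) : ℕ := tokenCount m + winCount m

/-- Number of tokens of rank `r` held by a node. -/
def heldOf (r : Rank n) (s : State n d) : ℕ := if s.best = r then s.held else 0

/-- Number of notifications for rank `r` that a node has to forward. -/
def pendingOf (r : Rank n) (s : State n d) : ℕ := if s.best = r then s.pending else 0

/-- Number of notifications for rank `r` counted by a node. -/
def countedOf (r : Rank n) (s : State n d) : ℕ := if s.own = r then s.wins else 0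

/-- Number of tokens or notifications that a node passes on in the next round. -/
def load (T : ℕ) (s : State n d) : ℕ :=
  if s.clock < T + 1 then s.held else if s.clock < 2 * (T + 1) then s.pending else 0

variable (c : Coins n T d) (s : State n d) (x : Fin d)

theorem best_eq_of_pendingOf_pos {r : Rank n} {s : State n d} (h : 0 < pendingOf r s) :
    s.best = r := by
  by_contra hb
  rw [pendingOf, if_neg hb] at h
  exact h.false

theorem send_of_best_eq_bot (h : s.best = ⊥) : send n T d c s x = none := by
  simp only [send, h]

theorem send_of_clock_lt {r : Rank n} (hb : s.best = r) (hc : s.clock < T + 1) :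
    send n T d c s x = if 0 < sampleCount c ⟨s.clock, hc⟩ r s.held x then
      some (.token r (sampleCount c ⟨s.clock, hc⟩ r s.held x)) else none := by
  simp only [send, hb, dif_pos hc]

theorem send_of_le_clock {r : Rank n} (hb : s.best = r) (hc : T + 1 ≤ s.clock) :
    send n T d c s x = if s.clock < 2 * (T + 1) ∧ 0 < s.pending ∧ s.origin = some x then
      some (.win r s.pending) else none := by
  simp only [send, hb, dif_neg (not_lt.2 hc)]

theorem send_of_two_mul_le_clock (hc : 2 * (T + 1) ≤ s.clock) : send n T d c s x = none := by
  induction h : s.best using WithBot.recBotCoe with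
  | bot => exact send_of_best_eq_bot c s x h
  | coe r => rw [send_of_le_clock c s x h (by omega), if_neg (by omega)]

theorem tokenRank_send_eq_bot_or : tokenRank (send n T d c s x) = ⊥ ∨
    tokenRank (send n T d c s x) = s.best := by
  induction hb : s.best using WithBot.recBotCoe with
  | bot => exact .inl (by simp [send_of_best_eq_bot c s x hb, tokenRank])
  | coe r =>
    rcases lt_or_ge s.clock (T + 1) with hc | hc
    · rw [send_of_clock_lt c s x hb hc]
      split_ifs <;> simp [tokenRank]
    · rw [send_of_le_clock c s x hb hc]
      split_ifs <;> simp [tokenRank]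

theorem tokenRank_send_le : tokenRank (send n T d c s x) ≤ s.best := by
  rcases tokenRank_send_eq_bot_or c s x with h | h
  · exact h ▸ bot_le
  · exact h.le

theorem best_eq_of_tokenRank_send {r : Rank n} (h : tokenRank (send n T d c s x) = r) :
    s.best = r := by
  rcases tokenRank_send_eq_bot_or c s x with h' | h'
  · exact absurd (h'.symm.trans h) WithBot.bot_ne_coe
  · exact h'.symm.trans h

theorem tokensOf_send (hc : s.clock < T + 1) (r : Rank n) :
    tokensOf r (send n T d c s x) = sampleCount c ⟨s.clock, hc⟩ r (heldOf r s) x := by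
  induction hb : s.best using WithBot.recBotCoe with
  | bot => simp [send_of_best_eq_bot c s x hb, tokensOf, tokenRank, heldOf, hb, sampleCount]
  | coe r' =>
    rw [send_of_clock_lt c s x hb hc]
    by_cases hr : r' = r
    · subst hr
      split_ifs with h <;> simp_all [tokensOf, tokenRank, tokenCount, heldOf]
    · have : (r' : WithBot (Rank n)) ≠ r := WithBot.coe_injective.ne hr
      split_ifs <;> simp_all [tokensOf, tokenRank, heldOf, sampleCount]

theorem winsOf_send (hc : T + 1 ≤ s.clock) (hc' : s.clock < 2 * (T + 1)) (r : Rank n) :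
    winsOf r (send n T d c s x) = if s.origin = some x then pendingOf r s else 0 := by
  induction hb : s.best using WithBot.recBotCoe with
  | bot => simp [send_of_best_eq_bot c s x hb, winsOf, winRank, pendingOf, hb]
  | coe r' =>
    rw [send_of_le_clock c s x hb hc]
    by_cases hr : r' = r
    · subst hr
      by_cases hx : s.origin = some x <;> by_cases hp : 0 < s.pending <;>
        simp_all [winsOf, winRank, winCount, pendingOf]
    · have : (r' : WithBot (Rank n)) ≠ r := WithBot.coe_injective.ne hr
      by_cases hx : s.origin = some x <;> by_cases hp : 0 < s.pending <;>
        simp_all [winsOf, winRank, pendingOf]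

theorem one_le_msgCount_send (h : (send n T d c s x).isSome) :
    1 ≤ msgCount (send n T d c s x) := by
  induction hb : s.best using WithBot.recBotCoe with
  | bot => simp [send_of_best_eq_bot c s x hb] at h
  | coe r =>
    rcases lt_or_ge s.clock (T + 1) with hc | hc
    · rw [send_of_clock_lt c s x hb hc] at h ⊢
      split_ifs at h ⊢ with hpos <;> simp_all [msgCount, tokenCount, winCount]
      omega
    · rw [send_of_le_clock c s x hb hc] at h ⊢
      split_ifs at h ⊢ with hpos <;> simp_all [msgCount, tokenCount, winCount]
      omega

theorem sum_msgCount_send_le : ∑ x, msgCount (send n T d c s x) ≤ load T s := by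
  induction hb : s.best using WithBot.recBotCoe with
  | bot => simp [send_of_best_eq_bot c s _ hb, msgCount, tokenCount, winCount]
  | coe r =>
    unfold load
    split_ifs with hc hc'
    · calc ∑ x, msgCount (send n T d c s x)
          ≤ ∑ x, sampleCount c ⟨s.clock, hc⟩ r s.held x := Finset.sum_le_sum fun x _ => by
            rw [send_of_clock_lt c s x hb hc]
            split_ifs <;> simp [msgCount, tokenCount, winCount]
        _ ≤ s.held := (sum_sampleCount _ _ _ _).trans_le (min_le_right _ _)
    · calc ∑ x, msgCount (send n T d c s x)
          ≤ ∑ x, if s.origin = some x then s.pending else 0 := Finset.sum_le_sum fun x _ => by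
            rw [send_of_le_clock c s x hb (not_lt.1 hc)]
            split_ifs <;> simp_all [msgCount, tokenCount, winCount]
        _ ≤ s.pending := by cases s.origin <;> simp
    · simp [send_of_two_mul_le_clock c s _ (not_lt.1 hc'), msgCount, tokenCount, winCount]

theorem card_isSome_send_le_load :
    (Finset.univ.filter fun x => (send n T d c s x).isSome = true).card ≤ load T s := by
  rw [Finset.card_filter]
  refine (Finset.sum_le_sum fun x _ => ?_).trans (sum_msgCount_send_le c s)
  split_ifs with h
  · exact one_le_msgCount_send c s x h
  · exact Nat.zero_le _

theorem msgCount_send_le_load : msgCount (send n T d c s x) ≤ load T s :=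
  (Finset.single_le_sum (fun _ _ => Nat.zero_le _) (Finset.mem_univ x)).trans
    (sum_msgCount_send_le c s)

theorem sum_winsOf_send_le (hc : T + 1 ≤ s.clock) (hc' : s.clock < 2 * (T + 1)) (r : Rank n) :
    ∑ x, winsOf r (send n T d c s x) ≤ pendingOf r s := by
  simp only [winsOf_send c s _ hc hc']
  cases s.origin <;> simp

theorem exists_code_le (m : Msg n) :
    ∃ r : Rank n, m.code ≤ 2 * Nat.pair r.1 (msgCount (some m)) + 1 := by
  rcases m with ⟨r, k⟩ | ⟨r, k⟩
  · exact ⟨r, Nat.le_succ _⟩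
  · exact ⟨r, by simp [Msg.code, msgCount, tokenCount, winCount]⟩

end Send

/-! ### The reception of messages by a node -/

section Receive

variable {n T d : ℕ} (pick : PortChoice) (s : State n d) (inbox : Fin d → Option (Msg n))

theorem load_receive_le :
    load T (receive n T d pick s inbox) ≤ ∑ x, msgCount (inbox x) := by
  have htok : ∑ x, tokenCount (inbox x) ≤ ∑ x, msgCount (inbox x) :=
    Finset.sum_le_sum fun _ _ => Nat.le_add_right _ _
  have hwin : ∑ x, winCount (inbox x) ≤ ∑ x, msgCount (inbox x) :=
    Finset.sum_le_sum fun _ _ => Nat.le_add_left _ _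
  have hheld : (receiveToken T pick s inbox).held ≤ ∑ x, tokenCount (inbox x) := by
    simp only [receiveToken]
    exact Finset.sum_le_sum fun x _ => by split_ifs <;> simp
  have hpending : (receiveToken T pick s inbox).pending ≤ (receiveToken T pick s inbox).held := by
    simp only [receiveToken]
    split_ifs <;> simp
  have hwins : (receiveWin T s inbox).pending ≤ ∑ x, winCount (inbox x) := by
    simp only [receiveWin]
    exact Finset.sum_le_sum fun x _ => by split_ifs <;> simp
  have hclock : (receiveWin T s inbox).clock = s.clock + 1 := rfl
  unfold load receive
  split_ifs <;> omega

theorem heldOf_receiveToken (r : Rank n) :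
    heldOf r (receiveToken T pick s inbox) =
      if (receiveToken T pick s inbox).best = r then ∑ y, tokensOf r (inbox y) else 0 := by
  unfold heldOf
  split_ifs with h
  · simp only [receiveToken] at h ⊢
    simp only [h, tokensOf]
  · rfl

theorem origin_receiveToken_of_best_eq (h : (receiveToken T pick s inbox).best = s.best) :
    (receiveToken T pick s inbox).origin = s.origin :=
  dif_neg fun h' => h'.1 h

theorem exists_origin_receiveToken (h : (receiveToken T pick s inbox).best ≠ s.best) :
    ∃ x, (receiveToken T pick s inbox).origin = some x ∧
      tokenRank (inbox x) = (receiveToken T pick s inbox).best := by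
  have hbest : (receiveToken T pick s inbox).best =
      s.best ⊔ Finset.univ.sup fun x => tokenRank (inbox x) := rfl
  have hsup : (receiveToken T pick s inbox).best = Finset.univ.sup fun x => tokenRank (inbox x) :=
    hbest.trans (sup_eq_right.2 ((le_total _ _).resolve_right fun hle =>
      h (hbest.trans (sup_eq_left.2 hle))))
  have hne : (Finset.univ : Finset (Fin d)).Nonempty := by
    by_contra hempty
    rw [Finset.not_nonempty_iff_eq_empty.1 hempty, Finset.sup_empty] at hbest
    exact h (hbest.trans (sup_bot_eq _))
  obtain ⟨x, hx, hxsup⟩ := Finset.exists_mem_eq_sup _ hne fun x => tokenRank (inbox x)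
  have hfrom : (Finset.univ.filter fun x =>
      tokenRank (inbox x) = (receiveToken T pick s inbox).best).Nonempty :=
    ⟨x, Finset.mem_filter.2 ⟨hx, (hsup.trans hxsup).symm⟩⟩
  exact ⟨_, dif_pos ⟨h, hfrom⟩, (Finset.mem_filter.1 (pick d _ hfrom).2).2⟩

theorem countedOf_add_pendingOf_receiveToken (h : s.clock = T) (r : Rank n) :
    countedOf r (receiveToken T pick s inbox) + pendingOf r (receiveToken T pick s inbox) =
      heldOf r (receiveToken T pick s inbox) := by
  simp only [countedOf, pendingOf, heldOf, receiveToken, h, true_and]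
  split_ifs <;> simp_all

theorem pendingOf_receiveToken_of_own_eq {r : Rank n} (h : s.own = r) :
    pendingOf r (receiveToken T pick s inbox) = 0 := by
  simp only [pendingOf, receiveToken, h]
  split_ifs <;> simp_all

theorem countedOf_receiveWin (r : Rank n) : countedOf r (receiveWin T s inbox) =
    countedOf r s + if s.own = r then ∑ y, winsOf r (inbox y) else 0 := by
  by_cases h : s.own = r <;> simp [countedOf, receiveWin, winsOf, h]

theorem pendingOf_receiveWin (r : Rank n) : pendingOf r (receiveWin T s inbox) =
    if s.best = r ∧ s.own ≠ r then ∑ y, winsOf r (inbox y) else 0 := by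
  by_cases hb : s.best = r <;> by_cases ho : s.own = r
  · simp [pendingOf, receiveWin, hb, ho]
  · simp only [pendingOf, receiveWin, winsOf, hb, ho, ne_eq, not_false_eq_true, and_self, if_true]
    refine Finset.sum_congr rfl fun y _ => ?_
    by_cases hy : winRank (inbox y) = r <;> simp [hy, Ne.symm ho]
  · simp [pendingOf, receiveWin, hb]
  · simp [pendingOf, receiveWin, hb]

theorem countedOf_add_pendingOf_receiveWin (r : Rank n) :
    countedOf r (receiveWin T s inbox) + pendingOf r (receiveWin T s inbox) =
      countedOf r s + if s.own = r ∨ s.best = r then ∑ y, winsOf r (inbox y) else 0 := by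
  rw [countedOf_receiveWin, pendingOf_receiveWin, add_assoc]
  by_cases ho : s.own = r <;> by_cases hb : s.best = r <;> simp [ho, hb]

end Receive

/-! ### Executions -/

/-- Own rank of a node with coins `c`, `⊥` if the node is not a candidate. -/
def ownRank {n T d : ℕ} (c : Coins n T d) : WithBot (Rank n) :=
  if c.1 then (c.2.1 : WithBot (Rank n)) else ⊥

theorem ownRank_eq_coe {n T d : ℕ} {c : Coins n T d} {r : Rank n} :
    ownRank c = r ↔ c.1 = true ∧ c.2.1 = r := by
  unfold ownRank
  split_ifs with h <;> simp [h]

section Run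

variable {V : Type*} [Fintype V] {G : SimpleGraph V} [DecidableRel G.Adj]
  (ports : PortNumbering G) {n T : ℕ} (pick : PortChoice) (ω : Outcomes G n T)

/-- State of node `v` after `t` rounds. -/
noncomputable def stateAt (t : ℕ) (v : V) : State n (G.degree v) :=
  (algorithm n T pick).run ports ω t v

/-- Message that node `v` sends through port `x` in round `t`. -/
noncomputable def sentAt (t : ℕ) (v : V) (x : Fin (G.degree v)) : Option (Msg n) :=
  send n T _ (ω v) (stateAt ports pick ω t v) x

/-- Message that node `v` finds at its port `y` in round `t`. -/
noncomputable def inboxAt (t : ℕ) (v : V) (y : Fin (G.degree v)) : Option (Msg n) :=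
  sentAt ports pick ω t (ports v y) (backPort ports v y)

theorem stateAt_succ (t : ℕ) (v : V) : stateAt ports pick ω (t + 1) v =
    receive n T _ pick (stateAt ports pick ω t v) (inboxAt ports pick ω t v) := rfl

theorem clock_stateAt {t : ℕ} (ht : t ≤ 2 * (T + 1)) (v : V) :
    (stateAt ports pick ω t v).clock = t := by
  induction t with
  | zero => rfl
  | succ t ih =>
    have ih := ih (by omega)
    rw [stateAt_succ, receive, ih]
    by_cases h : t < T + 1
    · rw [if_pos h]
      exact congrArg (· + 1) ih
    · rw [if_neg h, if_pos (by omega)]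
      exact congrArg (· + 1) ih

theorem stateAt_succ_of_lt {t : ℕ} (ht : t < T + 1) (v : V) : stateAt ports pick ω (t + 1) v =
    receiveToken T pick (stateAt ports pick ω t v) (inboxAt ports pick ω t v) := by
  rw [stateAt_succ, receive, clock_stateAt ports pick ω (by omega), if_pos ht]

theorem stateAt_succ_of_le {t : ℕ} (ht : T + 1 ≤ t) (ht' : t < 2 * (T + 1)) (v : V) :
    stateAt ports pick ω (t + 1) v =
      receiveWin T (stateAt ports pick ω t v) (inboxAt ports pick ω t v) := by
  rw [stateAt_succ, receive, clock_stateAt ports pick ω (by omega), if_neg (by omega), if_pos ht']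

theorem stateAt_of_two_mul_le {t : ℕ} (ht : 2 * (T + 1) ≤ t) (v : V) :
    stateAt ports pick ω t v = stateAt ports pick ω (2 * (T + 1)) v := by
  induction t, ht using Nat.le_induction with
  | base => rfl
  | succ t ht ih =>
    rw [stateAt_succ, receive, ih, clock_stateAt ports pick ω le_rfl, if_neg (by omega),
      if_neg (by omega)]

theorem own_stateAt (t : ℕ) (v : V) : (stateAt ports pick ω t v).own = ownRank (ω v) := by
  induction t with
  | zero => rfl
  | succ t ih =>
    rw [stateAt_succ, receive]
    split_ifs <;> simp only [receiveToken, receiveWin, ih]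

theorem sentAt_eq_none {t : ℕ} (ht : 2 * (T + 1) ≤ t) (v : V) (x : Fin (G.degree v)) :
    sentAt ports pick ω t v x = none :=
  send_of_two_mul_le_clock _ _ _ <| by
    rw [stateAt_of_two_mul_le ports pick ω ht, clock_stateAt ports pick ω le_rfl]

theorem winsOf_sentAt {t : ℕ} (ht : T + 1 ≤ t) (ht' : t < 2 * (T + 1)) (r : Rank n) (v : V)
    (x : Fin (G.degree v)) : winsOf r (sentAt ports pick ω t v x) =
      if (stateAt ports pick ω t v).origin = some x then pendingOf r (stateAt ports pick ω t v)
      else 0 := by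
  have hclock := clock_stateAt ports pick ω ht'.le v
  exact winsOf_send _ _ _ (by omega) (by omega) r

theorem tokensOf_inboxAt {t : ℕ} (ht : t < T + 1) (r : Rank n) (v : V) (y : Fin (G.degree v)) :
    tokensOf r (inboxAt ports pick ω t v y) =
      sampleCount (ω (ports v y)) ⟨t, ht⟩ r (heldOf r (stateAt ports pick ω t (ports v y)))
        (backPort ports v y) := by
  have hclock := clock_stateAt ports pick ω (show t ≤ 2 * (T + 1) by omega) (ports v y)
  rw [inboxAt, sentAt, tokensOf_send _ _ _ (hclock.trans_lt ht)]
  congr 1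
  exact Fin.ext hclock

/-! ### The number and the size of messages -/

/-- Number of candidates. -/
def numCandidates : ℕ := (Finset.univ.filter fun v => (ω v).1 = true).card

theorem numCandidates_le_card : numCandidates ω ≤ Fintype.card V :=
  Finset.card_le_univ _

theorem sum_load_stateAt_le (t : ℕ) :
    ∑ v, load T (stateAt ports pick ω t v) ≤ numCandidates ω * numTokens n := by
  induction t with
  | zero =>
    change ∑ v, (if 0 < T + 1 then if (ω v).1 then numTokens n else 0 else _) ≤ _
    simp only [Nat.succ_pos, if_true, ← Finset.sum_filter, Finset.sum_const, smul_eq_mul,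
      numCandidates, le_refl]
  | succ t ih =>
    refine le_trans ?_ ih
    calc ∑ v, load T (stateAt ports pick ω (t + 1) v)
        ≤ ∑ v, ∑ y, msgCount (inboxAt ports pick ω t v y) :=
          Finset.sum_le_sum fun v _ => load_receive_le pick _ _
      _ = ∑ u, ∑ x, msgCount (sentAt ports pick ω t u x) :=
          sum_reversePort ports fun _ u x => msgCount (sentAt ports pick ω t u x)
      _ ≤ ∑ u, load T (stateAt ports pick ω t u) :=
          Finset.sum_le_sum fun u _ => sum_msgCount_send_le _ _

theorem sum_card_sentAt_le (t : ℕ) :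
    ∑ v : V, (Finset.univ.filter fun x => (sentAt ports pick ω t v x).isSome = true).card ≤
      if t < 2 * (T + 1) then numCandidates ω * numTokens n else 0 := by
  split_ifs with ht
  · exact (Finset.sum_le_sum fun v _ => card_isSome_send_le_load _ _).trans
      (sum_load_stateAt_le ports pick ω t)
  · simp [sentAt_eq_none ports pick ω (not_lt.1 ht)]

theorem messages_le (t : ℕ) : (algorithm n T pick).messages ports ω t ≤
    2 * (T + 1) * (numCandidates ω * numTokens n) := by
  calc (algorithm n T pick).messages ports ω t
      ≤ ∑ s ∈ Finset.range t, if s < 2 * (T + 1) then numCandidates ω * numTokens n else 0 :=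
        Finset.sum_le_sum fun s _ => sum_card_sentAt_le ports pick ω s
    _ = ((Finset.range t).filter (· < 2 * (T + 1))).card * (numCandidates ω * numTokens n) := by
        rw [← Finset.sum_filter, Finset.sum_const, smul_eq_mul]
    _ ≤ 2 * (T + 1) * (numCandidates ω * numTokens n) := by
        refine Nat.mul_le_mul_right _ ((Finset.card_le_card fun s hs => ?_).trans_eq
          (Finset.card_range _))
        exact Finset.mem_range.2 (Finset.mem_filter.1 hs).2

theorem exists_code_sentAt_le {t : ℕ} {v : V} {x : Fin (G.degree v)} {m : Msg n}
    (h : sentAt ports pick ω t v x = some m) :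
    ∃ r : Rank n, ∃ k ≤ Fintype.card V * numTokens n, m.code ≤ 2 * Nat.pair r.1 k + 1 := by
  obtain ⟨r, hr⟩ := exists_code_le m
  refine ⟨r, _, ?_, hr⟩
  calc msgCount (some m) ≤ load T (stateAt ports pick ω t v) := h ▸ msgCount_send_le_load _ _ _
    _ ≤ ∑ v, load T (stateAt ports pick ω t v) :=
        Finset.single_le_sum (f := fun v => load T (stateAt ports pick ω t v))
          (fun _ _ => Nat.zero_le _) (Finset.mem_univ v)
    _ ≤ numCandidates ω * numTokens n := sum_load_stateAt_le ports pick ω t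
    _ ≤ Fintype.card V * numTokens n := Nat.mul_le_mul_right _ (numCandidates_le_card ω)

/-! ### The walks of the algorithm -/

theorem heldOf_stateAt_succ {t : ℕ} (ht : t < T + 1) (r : Rank n) (v : V) :
    heldOf r (stateAt ports pick ω (t + 1) v) =
      if (stateAt ports pick ω (t + 1) v).best = r then
        ∑ y, sampleCount (ω (ports v y)) ⟨t, ht⟩ r
          (heldOf r (stateAt ports pick ω t (ports v y))) (backPort ports v y)
      else 0 := by
  rw [stateAt_succ_of_lt ports pick ω ht, heldOf_receiveToken]
  simp only [tokensOf_inboxAt ports pick ω ht]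

theorem best_stateAt_succ {t : ℕ} (ht : t < T + 1) (v : V) :
    (stateAt ports pick ω (t + 1) v).best = (stateAt ports pick ω t v).best ⊔
      Finset.univ.sup fun y => tokenRank (inboxAt ports pick ω t v y) := by
  rw [stateAt_succ_of_lt ports pick ω ht]
  rfl

section Max

variable {ω} {r : Rank n} (hmax : ∀ v, ownRank (ω v) ≤ r)
include hmax

theorem best_stateAt_le {t : ℕ} (ht : t ≤ T + 1) (v : V) :
    (stateAt ports pick ω t v).best ≤ r := by
  induction t generalizing v with
  | zero => exact hmax v
  | succ t ih =>
    rw [best_stateAt_succ ports pick ω (by omega)]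
    exact sup_le (ih (by omega) v) (Finset.sup_le fun y _ =>
      (tokenRank_send_le _ _ _).trans (ih (by omega) _))

theorem best_stateAt_succ_eq_of_best {t : ℕ} (ht : t < T + 1) {v : V}
    (hv : (stateAt ports pick ω t v).best = r) : (stateAt ports pick ω (t + 1) v).best = r := by
  refine le_antisymm (best_stateAt_le ports pick hmax ht v) ?_
  rw [best_stateAt_succ ports pick ω ht, hv]
  exact le_sup_left

theorem best_stateAt_succ_eq_of_tokenRank {t : ℕ} (ht : t < T + 1) {v : V} {y : Fin (G.degree v)}
    (hy : tokenRank (inboxAt ports pick ω t v y) = r) :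
    (stateAt ports pick ω (t + 1) v).best = r := by
  refine le_antisymm (best_stateAt_le ports pick hmax ht v) ?_
  rw [best_stateAt_succ ports pick ω ht, ← hy]
  exact le_sup_of_le_right
    (Finset.le_sup (f := fun y => tokenRank (inboxAt ports pick ω t v y)) (Finset.mem_univ y))

end Max

section WalkCount

variable [DecidableEq V] {ω} {r : Rank n} {u : V} (hu : ∀ v, ownRank (ω v) = r ↔ v = u)
include hu

theorem heldOf_stateAt_zero (v : V) :
    heldOf r (stateAt ports pick ω 0 v) = walkCount ports ω r u 0 v := by
  change (if ownRank (ω v) = r then if (ω v).1 then numTokens n else 0 else 0) =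
    (Pi.single u (numTokens n) : V → ℕ) v
  by_cases hv : v = u
  · subst hv
    simp [(ownRank_eq_coe.1 ((hu v).2 rfl)).1, (hu v).2 rfl]
  · simp [mt (hu v).1 hv, hv]

theorem heldOf_le_walkCount {t : ℕ} (ht : t ≤ T + 1) (v : V) :
    heldOf r (stateAt ports pick ω t v) ≤ walkCount ports ω r u t v := by
  induction t generalizing v with
  | zero => exact (heldOf_stateAt_zero ports pick hu v).le
  | succ t ih =>
    have ht' : t < T + 1 := by omega
    rw [heldOf_stateAt_succ ports pick ω ht', walkCount_succ ports ω r u ht']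
    split_ifs
    · exact Finset.sum_le_sum fun y _ => sampleCount_mono _ _ _ (ih (by omega) _) _
    · exact Nat.zero_le _

theorem heldOf_eq_walkCount (hmax : ∀ v, ownRank (ω v) ≤ r) {t : ℕ} (ht : t ≤ T + 1) (v : V) :
    heldOf r (stateAt ports pick ω t v) = walkCount ports ω r u t v := by
  induction t generalizing v with
  | zero => exact heldOf_stateAt_zero ports pick hu v
  | succ t ih =>
    have ht' : t < T + 1 := by omega
    rw [heldOf_stateAt_succ ports pick ω ht', walkCount_succ ports ω r u ht']
    simp only [← ih (show t ≤ T + 1 by omega)]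
    split_ifs with hb
    · rfl
    · refine (Finset.sum_eq_zero fun y _ => ?_).symm
      rw [← tokensOf_inboxAt ports pick ω ht', tokensOf, if_neg]
      exact fun hy => hb (best_stateAt_succ_eq_of_tokenRank ports pick hmax ht' hy)

end WalkCount

/-! ### The tree of origin pointers -/

/-- In the network state `s`, the origin pointers of the nodes with winner-so-far `r` lead to the
candidate of rank `r`: they point to nodes with winner-so-far `r` and smaller level `L`. -/
def IsOriginLevel (s : (v : V) → State n (G.degree v)) (r : Rank n) (L : V → ℕ) : Prop :=
  ∀ v, (s v).best = r → (s v).own ≠ r →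
    ∃ x, (s v).origin = some x ∧ (s (ports v x)).best = r ∧ L (ports v x) < L v

variable {ω} {r : Rank n}

-- The level of a node is the round in which it was reached by a token of rank `r`.
theorem IsOriginLevel.succ (hmax : ∀ v, ownRank (ω v) ≤ r) {t : ℕ} (ht : t < T + 1) {L : V → ℕ}
    (hL : IsOriginLevel ports (stateAt ports pick ω t) r L) (hLt : ∀ v, L v ≤ t) :
    IsOriginLevel ports (stateAt ports pick ω (t + 1)) r
      fun v => if (stateAt ports pick ω t v).best = r then L v else t + 1 := by
  intro v hb hown
  have hsucc := stateAt_succ_of_lt ports pick ω ht v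
  by_cases hbt : (stateAt ports pick ω t v).best = r
  · obtain ⟨x, hx, hbx, hLx⟩ := hL v hbt (by rwa [own_stateAt] at hown ⊢)
    refine ⟨x, ?_, best_stateAt_succ_eq_of_best ports pick hmax ht hbx, by simp [hbt, hbx, hLx]⟩
    rw [hsucc] at hb ⊢
    rw [origin_receiveToken_of_best_eq pick _ _ (hb.trans hbt.symm), hx]
  · obtain ⟨x, hx, hrank⟩ := exists_origin_receiveToken (T := T) pick
      (stateAt ports pick ω t v) (inboxAt ports pick ω t v) (by rwa [← hsucc, hb, ne_comm])
    rw [← hsucc] at hx hrank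
    have hbx := best_eq_of_tokenRank_send _ _ _ (hrank.trans hb)
    refine ⟨x, hx, best_stateAt_succ_eq_of_best ports pick hmax ht hbx, ?_⟩
    simp only [hbx, hbt, if_true, if_false]
    exact Nat.lt_succ_of_le (hLt _)

theorem exists_isOriginLevel (hmax : ∀ v, ownRank (ω v) ≤ r) {t : ℕ} (ht : t ≤ T + 1) :
    ∃ L : V → ℕ, IsOriginLevel ports (stateAt ports pick ω t) r L ∧ ∀ v, L v ≤ t := by
  induction t with
  | zero => exact ⟨fun _ => 0, fun v hb hown => absurd hb hown, fun _ => le_rfl⟩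
  | succ t ih =>
    obtain ⟨L, hL, hLt⟩ := ih (by omega)
    refine ⟨_, hL.succ ports pick hmax (by omega) hLt, fun v => ?_⟩
    split_ifs
    · exact (hLt v).trans (Nat.le_succ t)
    · exact le_rfl

theorem IsOriginLevel.of_le {t : ℕ} (ht : T + 1 ≤ t) (ht' : t ≤ 2 * (T + 1)) {L : V → ℕ}
    (hL : IsOriginLevel ports (stateAt ports pick ω (T + 1)) r L) :
    IsOriginLevel ports (stateAt ports pick ω t) r L := by
  induction t, ht using Nat.le_induction with
  | base => exact hL
  | succ t ht ih =>
    intro v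
    simp only [stateAt_succ_of_le ports pick ω ht (show t < 2 * (T + 1) by omega)]
    exact ih (by omega) v

/-! ### The notifications -/

theorem pendingOf_stateAt_of_own_eq {t : ℕ} (ht : T + 1 ≤ t) (ht' : t ≤ 2 * (T + 1)) {v : V}
    (hv : ownRank (ω v) = r) : pendingOf r (stateAt ports pick ω t v) = 0 := by
  obtain rfl | ht := ht.eq_or_lt
  · rw [stateAt_succ_of_lt ports pick ω (Nat.lt_succ_self T)]
    exact pendingOf_receiveToken_of_own_eq pick _ _ (by rw [own_stateAt, hv])
  · obtain ⟨t, rfl⟩ := Nat.exists_eq_add_one_of_ne_zero (show t ≠ 0 by omega)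
    rw [stateAt_succ_of_le ports pick ω (by omega) (by omega), pendingOf_receiveWin,
      if_neg fun h => h.2 (by rw [own_stateAt, hv])]

theorem IsOriginLevel.exists_parent {t : ℕ} (ht : T + 1 ≤ t) (ht' : t ≤ 2 * (T + 1)) {L : V → ℕ}
    (hL : IsOriginLevel ports (stateAt ports pick ω t) r L) {v : V}
    (hv : 0 < pendingOf r (stateAt ports pick ω t v)) :
    ∃ x, (stateAt ports pick ω t v).origin = some x ∧
      (stateAt ports pick ω t (ports v x)).best = r ∧ L (ports v x) < L v := by
  refine hL v (best_eq_of_pendingOf_pos hv) fun hown => hv.ne' ?_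
  exact pendingOf_stateAt_of_own_eq ports pick ht ht' (by rwa [own_stateAt] at hown)

theorem exists_origin_of_pendingOf_succ_pos {t : ℕ} (ht : T + 1 ≤ t) (ht' : t < 2 * (T + 1))
    {v : V} (hv : 0 < pendingOf r (stateAt ports pick ω (t + 1) v)) :
    ∃ y, (stateAt ports pick ω t (ports v y)).origin = some (backPort ports v y) ∧
      0 < pendingOf r (stateAt ports pick ω t (ports v y)) := by
  rw [stateAt_succ_of_le ports pick ω ht ht', pendingOf_receiveWin] at hv
  split_ifs at hv
  · obtain ⟨y, -, hy⟩ := Finset.exists_ne_zero_of_sum_ne_zero hv.ne'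
    rw [inboxAt, winsOf_sentAt ports pick ω ht ht'] at hy
    split_ifs at hy with ho
    · exact ⟨y, ho, Nat.pos_of_ne_zero hy⟩
    · exact absurd rfl hy
  · exact absurd hv (lt_irrefl 0)

theorem IsOriginLevel.level_add_le {L : V → ℕ}
    (hL : IsOriginLevel ports (stateAt ports pick ω (T + 1)) r L) (hLT : ∀ v, L v ≤ T + 1) {t : ℕ}
    (ht : T + 1 ≤ t) (ht' : t ≤ 2 * (T + 1)) {v : V}
    (hv : 0 < pendingOf r (stateAt ports pick ω t v)) : L v + t ≤ 2 * (T + 1) := by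
  induction t, ht using Nat.le_induction generalizing v with
  | base => linarith [hLT v]
  | succ t ht ih =>
    obtain ⟨y, ho, hp⟩ := exists_origin_of_pendingOf_succ_pos ports pick ht (by omega) hv
    obtain ⟨x, hx, -, hlt⟩ :=
      (hL.of_le ports pick ht (by omega)).exists_parent ports pick ht (by omega) hp
    obtain rfl : x = backPort ports v y := Option.some_injective _ (hx.symm.trans ho)
    rw [ports_backPort] at hlt
    have := ih (by omega) hp
    omega

theorem pendingOf_two_mul_eq_zero (hmax : ∀ v, ownRank (ω v) ≤ r) (v : V) :
    pendingOf r (stateAt ports pick ω (2 * (T + 1)) v) = 0 := by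
  obtain ⟨L, hL, hLT⟩ := exists_isOriginLevel ports pick hmax le_rfl
  by_contra hv
  have hv := Nat.pos_of_ne_zero hv
  obtain ⟨x, -, -, hlt⟩ :=
    (hL.of_le ports pick (by omega) le_rfl).exists_parent ports pick (by omega) le_rfl hv
  have := hL.level_add_le ports pick hLT (by omega) le_rfl hv
  omega

variable (r) in
/-- Number of notifications for rank `r` after `t` rounds, counted or still to be forwarded. -/
noncomputable def notifications (ω : Outcomes G n T) (t : ℕ) : ℕ :=
  ∑ v, (countedOf r (stateAt ports pick ω t v) + pendingOf r (stateAt ports pick ω t v))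

theorem notifications_succ_eq_sum_heldOf :
    notifications ports pick r ω (T + 1) = ∑ v, heldOf r (stateAt ports pick ω (T + 1) v) := by
  refine Finset.sum_congr rfl fun v _ => ?_
  rw [stateAt_succ_of_lt ports pick ω (Nat.lt_succ_self T)]
  exact countedOf_add_pendingOf_receiveToken pick _ _ (clock_stateAt ports pick ω (by omega) v) r

theorem notifications_succ {t : ℕ} (ht : T + 1 ≤ t) (ht' : t < 2 * (T + 1)) :
    notifications ports pick r ω (t + 1) = ∑ v, countedOf r (stateAt ports pick ω t v) +
      ∑ w, ∑ x, if ownRank (ω (ports w x)) = r ∨ (stateAt ports pick ω t (ports w x)).best = r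
        then winsOf r (sentAt ports pick ω t w x) else 0 := by
  rw [← sum_reversePort ports fun v w x =>
    if ownRank (ω v) = r ∨ (stateAt ports pick ω t v).best = r
      then winsOf r (sentAt ports pick ω t w x) else 0]
  simp only [notifications, stateAt_succ_of_le ports pick ω ht ht',
    countedOf_add_pendingOf_receiveWin, Finset.sum_add_distrib, own_stateAt]
  refine congrArg _ (Finset.sum_congr rfl fun v _ => ?_)
  split_ifs
  · rfl
  · rw [Finset.sum_const_zero]

theorem notifications_succ_le {t : ℕ} (ht : T + 1 ≤ t) (ht' : t < 2 * (T + 1)) :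
    notifications ports pick r ω (t + 1) ≤ notifications ports pick r ω t := by
  have hclock (w : V) := clock_stateAt ports pick ω ht'.le w
  rw [notifications_succ ports pick ht ht', notifications, Finset.sum_add_distrib]
  refine Nat.add_le_add_left (Finset.sum_le_sum fun w _ => ?_) _
  calc _ ≤ ∑ x, winsOf r (sentAt ports pick ω t w x) :=
        Finset.sum_le_sum fun x _ => by split_ifs <;> simp
    _ ≤ pendingOf r (stateAt ports pick ω t w) :=
        sum_winsOf_send_le _ _ (by rwa [hclock]) (by rwa [hclock]) r

theorem notifications_le_sum_heldOf {t : ℕ} (ht : T + 1 ≤ t) (ht' : t ≤ 2 * (T + 1)) :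
    notifications ports pick r ω t ≤ ∑ v, heldOf r (stateAt ports pick ω (T + 1) v) := by
  induction t, ht using Nat.le_induction with
  | base => exact (notifications_succ_eq_sum_heldOf ports pick).le
  | succ t ht ih => exact (notifications_succ_le ports pick ht (by omega)).trans (ih (by omega))

theorem IsOriginLevel.notifications_succ_eq {t : ℕ} (ht : T + 1 ≤ t) (ht' : t < 2 * (T + 1))
    {L : V → ℕ} (hL : IsOriginLevel ports (stateAt ports pick ω t) r L) :
    notifications ports pick r ω (t + 1) = notifications ports pick r ω t := by
  rw [notifications_succ ports pick ht ht', notifications, Finset.sum_add_distrib]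
  refine congrArg _ (Finset.sum_congr rfl fun w _ => ?_)
  simp only [winsOf_sentAt ports pick ω ht ht']
  obtain h0 | hpos := Nat.eq_zero_or_pos (pendingOf r (stateAt ports pick ω t w))
  · simp [h0]
  obtain ⟨x, hx, hbx, -⟩ := hL.exists_parent ports pick ht ht'.le hpos
  rw [Finset.sum_eq_single x, if_pos (Or.inr hbx), if_pos hx]
  · intro x' _ hx'
    simp [hx, hx'.symm]
  · exact fun h => absurd (Finset.mem_univ x) h

theorem notifications_eq_sum_heldOf (hmax : ∀ v, ownRank (ω v) ≤ r) {t : ℕ} (ht : T + 1 ≤ t)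
    (ht' : t ≤ 2 * (T + 1)) :
    notifications ports pick r ω t = ∑ v, heldOf r (stateAt ports pick ω (T + 1) v) := by
  obtain ⟨L, hL, -⟩ := exists_isOriginLevel ports pick hmax le_rfl
  induction t, ht using Nat.le_induction with
  | base => exact notifications_succ_eq_sum_heldOf ports pick
  | succ t ht ih =>
    rw [(hL.of_le ports pick ht (by omega)).notifications_succ_eq ports pick ht (by omega),
      ih (by omega)]

theorem sum_countedOf_stateAt {u : V} (hu : ∀ v, ownRank (ω v) = r ↔ v = u) (t : ℕ) :
    ∑ v, countedOf r (stateAt ports pick ω t v) = (stateAt ports pick ω t u).wins := by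
  simp only [countedOf, own_stateAt]
  rw [Finset.sum_eq_single u, if_pos ((hu u).2 rfl)]
  · exact fun v _ hv => if_neg (mt (hu v).1 hv)
  · exact fun h => absurd (Finset.mem_univ u) h

theorem wins_eq_numTokens_of_forall_le {u : V} (hu : ∀ v, ownRank (ω v) = r ↔ v = u)
    (hmax : ∀ v, ownRank (ω v) ≤ r) (hn : 0 < n) :
    (stateAt ports pick ω (2 * (T + 1)) u).wins = numTokens n := by
  classical
  have h := notifications_eq_sum_heldOf ports pick hmax (show T + 1 ≤ 2 * (T + 1) by omega) le_rfl
  simpa only [notifications, pendingOf_two_mul_eq_zero ports pick hmax, add_zero,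
    sum_countedOf_stateAt ports pick hu, heldOf_eq_walkCount ports pick hu hmax le_rfl,
    sum_walkCount ports ω r u hn le_rfl] using h

theorem walkCount_eq_heldOf_of_wins_eq [DecidableEq V] {u : V}
    (hu : ∀ v, ownRank (ω v) = r ↔ v = u) (hn : 0 < n)
    (hwins : (stateAt ports pick ω (2 * (T + 1)) u).wins = numTokens n) (v : V) :
    walkCount ports ω r u (T + 1) v = heldOf r (stateAt ports pick ω (T + 1) v) := by
  have hle (v : V) := heldOf_le_walkCount ports pick hu (le_refl (T + 1)) v
  have hge : ∑ v, walkCount ports ω r u (T + 1) v ≤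
      ∑ v, heldOf r (stateAt ports pick ω (T + 1) v) := by
    rw [sum_walkCount ports ω r u hn le_rfl, ← hwins, ← sum_countedOf_stateAt ports pick hu]
    exact (Finset.sum_le_sum fun v _ => Nat.le_add_right _ _).trans
      (notifications_le_sum_heldOf ports pick (by omega) le_rfl)
  exact ((Finset.sum_eq_sum_iff_of_le fun v _ => hle v).1
    (le_antisymm (Finset.sum_le_sum fun v _ => hle v) hge) v (Finset.mem_univ v)).symm

end Run

/-! ### Election of the candidate of largest rank -/

section Election

variable {V : Type*} [Fintype V] {G : SimpleGraph V} [DecidableRel G.Adj]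
  {ports : PortNumbering G} {n T : ℕ} (pick : PortChoice) {ω : Outcomes G n T}

theorem status_stateAt (v : V) : (stateAt ports pick ω (2 * (T + 1)) v).status =
    if ownRank (ω v) ≠ ⊥ ∧ (stateAt ports pick ω (2 * (T + 1)) v).wins = numTokens n
      then Status.elected else Status.nonElected := by
  have hclock := clock_stateAt ports pick ω (show 2 * T + 1 ≤ 2 * (T + 1) by omega) v
  rw [show 2 * (T + 1) = 2 * T + 1 + 1 by ring,
    stateAt_succ_of_le ports pick ω (by omega) (by omega)]
  simp only [receiveWin, own_stateAt, hclock, if_true]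

variable [DecidableEq V]

/-- Coins for which the election succeeds: there is a candidate, the candidates have different
ranks, and the undisturbed walks of any two candidates meet at their end. -/
structure Good (ports : PortNumbering G) (ω : Outcomes G n T) : Prop where
  exists_candidate : ∃ v, (ω v).1 = true
  rank_injOn : ∀ u v, (ω u).1 = true → (ω v).1 = true → (ω u).2.1 = (ω v).2.1 → u = v
  meet : ∀ u v, (ω u).1 = true → (ω v).1 = true → u ≠ v →
    ∃ w, 0 < walkCount ports ω (ω u).2.1 u (T + 1) w ∧ 0 < walkCount ports ω (ω v).2.1 v (T + 1) w

theorem Good.ownRank_eq_iff (hω : Good ports ω) {u : V} (hu : (ω u).1 = true) (v : V) :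
    ownRank (ω v) = (ω u).2.1 ↔ v = u := by
  rw [ownRank_eq_coe]
  exact ⟨fun h => hω.rank_injOn v u h.1 hu h.2, by rintro rfl; exact ⟨hu, rfl⟩⟩

theorem Good.exists_forall_ownRank_le (hω : Good ports ω) :
    ∃ u, (ω u).1 = true ∧ ∀ v, ownRank (ω v) ≤ (ω u).2.1 := by
  obtain ⟨v₀, hv₀⟩ := hω.exists_candidate
  obtain ⟨u, -, hmax⟩ := Finset.exists_max_image Finset.univ (fun v => ownRank (ω v))
    ⟨v₀, Finset.mem_univ _⟩
  have hmax (v : V) : ownRank (ω v) ≤ ownRank (ω u) := hmax v (Finset.mem_univ v)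
  have hu : (ω u).1 = true := by
    by_contra h
    simpa [ownRank, h, hv₀] using hmax v₀
  exact ⟨u, hu, fun v => ownRank_eq_coe.2 ⟨hu, rfl⟩ ▸ hmax v⟩

-- Two candidates that got all their notifications would both have a token at a common node.
theorem Good.eq_of_wins_eq (hω : Good ports ω) (hn : 0 < n) {u v : V} (hu : (ω u).1 = true)
    (hv : (ω v).1 = true) (hwu : (stateAt ports pick ω (2 * (T + 1)) u).wins = numTokens n)
    (hwv : (stateAt ports pick ω (2 * (T + 1)) v).wins = numTokens n) : u = v := by
  by_contra hne
  obtain ⟨w, h₁, h₂⟩ := hω.meet u v hu hv hne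
  rw [walkCount_eq_heldOf_of_wins_eq ports pick (hω.ownRank_eq_iff hu) hn hwu] at h₁
  rw [walkCount_eq_heldOf_of_wins_eq ports pick (hω.ownRank_eq_iff hv) hn hwv] at h₂
  have hbest {r : Rank n} (h : 0 < heldOf r (stateAt ports pick ω (T + 1) w)) :
      (stateAt ports pick ω (T + 1) w).best = r := by
    by_contra hb
    simp [heldOf, hb] at h
  exact hne (hω.rank_injOn u v hu hv (WithBot.coe_injective ((hbest h₁).symm.trans (hbest h₂))))

theorem Good.leaderAt (hω : Good ports ω) (hn : 0 < n) {t : ℕ} (ht : 2 * (T + 1) ≤ t) :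
    (algorithm n T pick).LeaderAt ports ω t := by
  have hstatus (v : V) : (algorithm n T pick).status _ ((algorithm n T pick).run ports ω t v) =
      if ownRank (ω v) ≠ ⊥ ∧ (stateAt ports pick ω (2 * (T + 1)) v).wins = numTokens n
      then Status.elected else Status.nonElected := by
    rw [← status_stateAt, ← stateAt_of_two_mul_le ports pick ω ht]
    rfl
  obtain ⟨u, hu, hmax⟩ := hω.exists_forall_ownRank_le
  have hwins := wins_eq_numTokens_of_forall_le ports pick (hω.ownRank_eq_iff hu) hmax hn
  refine ⟨u, ?_, fun v hv => ?_⟩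
  · exact (hstatus u).trans (if_pos ⟨by simp [ownRank, hu], hwins⟩)
  · rw [hstatus, if_neg]
    rintro ⟨hown, hwv⟩
    have hcand : (ω v).1 = true := by
      by_contra h
      simp [ownRank, h] at hown
    exact hv (hω.eq_of_wins_eq pick hn hcand hu hwv hwins)

end Election

/-! ### The law of the coins -/

section Law

open ProbabilityTheory

/-- The probability with which a node becomes a candidate. -/
noncomputable def candProb (n : ℕ) : ℝ := 2 * Real.log n / n

theorem candProb_nonneg (n : ℕ) : 0 ≤ candProb n :=
  div_nonneg (mul_nonneg zero_le_two (Real.log_natCast_nonneg n)) n.cast_nonneg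

theorem candProb_pos {n : ℕ} (hn : 1 < n) : 0 < candProb n :=
  div_pos (mul_pos two_pos (Real.log_pos (Nat.one_lt_cast.2 hn))) (by positivity)

theorem candProb_lt_one (n : ℕ) : candProb n < 1 := by
  rcases n.eq_zero_or_pos with rfl | hn
  · simp [candProb]
  have hn' : (0 : ℝ) < n := Nat.cast_pos.2 hn
  have hlog : Real.log (n / 2) ≤ n / 2 - 1 := Real.log_le_sub_one_of_pos (by positivity)
  rw [Real.log_div hn'.ne' two_ne_zero] at hlog
  rw [candProb, div_lt_one hn']
  linarith [Real.log_two_lt_d9]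

instance (n : ℕ) : IsProbabilityMeasure (candidateLaw n) := by
  refine ⟨?_⟩
  change (ENNReal.ofReal (candProb n) • Measure.dirac true +
    ENNReal.ofReal (1 - candProb n) • Measure.dirac false) Set.univ = 1
  simp only [Measure.add_apply, Measure.smul_apply, measure_univ, smul_eq_mul, mul_one]
  rw [← ENNReal.ofReal_add (candProb_nonneg n) (sub_nonneg.2 (candProb_lt_one n).le),
    add_sub_cancel, ENNReal.ofReal_one]

theorem candidateLaw_real_true (n : ℕ) : (candidateLaw n).real {true} = candProb n := by
  change (ENNReal.ofReal (candProb n) • Measure.dirac true +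
    ENNReal.ofReal (1 - candProb n) • Measure.dirac false).real {true} = candProb n
  simp [measureReal_def, ENNReal.toReal_ofReal (candProb_nonneg n)]

theorem candidateLaw_real_false (n : ℕ) : (candidateLaw n).real {false} = 1 - candProb n := by
  rw [← candidateLaw_real_true, ← probReal_compl_eq_one_sub (MeasurableSet.singleton _)]
  congr 1
  ext b
  cases b <;> simp

instance (n : ℕ) [NeZero n] : Nonempty (Rank n) :=
  ⟨⟨1, le_rfl, Nat.one_le_pow _ _ (NeZero.pos n)⟩⟩

instance (n T d : ℕ) [NeZero n] [NeZero d] : IsProbabilityMeasure (coinLaw n T d) := by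
  unfold coinLaw
  infer_instance

theorem card_rank (n : ℕ) : Fintype.card (Rank n) = n ^ 4 := by
  simp [Rank, Fintype.card_ofFinset]

theorem uniformOn_univ_real_singleton {α : Type*} [Fintype α] [MeasurableSpace α]
    [MeasurableSingletonClass α] (a : α) :
    (uniformOn (Set.univ : Set α)).real {a} = (Fintype.card α : ℝ)⁻¹ := by
  simp [measureReal_def, uniformOn_univ]

theorem integral_uniformOn_univ {α : Type*} [Fintype α] [MeasurableSpace α]
    [MeasurableSingletonClass α] (f : α → ℝ) :
    ∫ a, f a ∂(uniformOn (Set.univ : Set α)) = (∑ a, f a) / Fintype.card α := by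
  simp only [integral_fintype .of_finite, uniformOn_univ_real_singleton, smul_eq_mul,
    ← Finset.mul_sum, div_eq_inv_mul]

variable {n T d : ℕ}

theorem coinLaw_singleton_congr {c c' : Coins n T d} (h : c.1 = c'.1) :
    coinLaw n T d {c} = coinLaw n T d {c'} := by
  obtain ⟨b, r, p⟩ := c
  obtain ⟨b', r', p'⟩ := c'
  obtain rfl : b = b' := h
  simp only [coinLaw, ← Set.singleton_prod_singleton, Measure.prod_prod, Measure.pi_singleton,
    uniformOn_univ, Measure.count_singleton]

theorem map_fst_coinLaw [NeZero n] [NeZero d] : (coinLaw n T d).map Prod.fst = candidateLaw n := by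
  simp only [coinLaw, Measure.map_fst_prod, measure_univ, one_smul]

theorem map_rank_coinLaw [NeZero d] :
    (coinLaw n T d).map (fun c => c.2.1) = uniformOn (Set.univ : Set (Rank n)) := by
  change (coinLaw n T d).map (Prod.fst ∘ Prod.snd) = _
  rw [← Measure.map_map measurable_fst measurable_snd]
  simp only [coinLaw, Measure.map_snd_prod, Measure.map_fst_prod, measure_univ, one_smul]

theorem map_ports_coinLaw [NeZero n] :
    (coinLaw n T d).map (fun c => c.2.2) =
      Measure.pi fun _ => uniformOn (Set.univ : Set (Fin d)) := by
  change (coinLaw n T d).map (Prod.snd ∘ Prod.snd) = _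
  rw [← Measure.map_map measurable_snd measurable_snd]
  simp only [coinLaw, Measure.map_snd_prod, measure_univ, one_smul]

theorem integral_pow_sampleCount [NeZero n] [NeZero d] (t : Fin (T + 1)) (r : Rank n) {k : ℕ}
    (hk : k ≤ n * numTokens n) (a : Fin d → ℝ) :
    ∫ c, ∏ x, a x ^ sampleCount c t r k x ∂(coinLaw n T d) = ((∑ x, a x) / d) ^ k := by
  let used : Finset (Fin (T + 1) × Rank n × Fin (n * numTokens n)) :=
    (Finset.univ.filter fun j : Fin (n * numTokens n) => j.1 < k).map
      ⟨fun j => (t, r, j), fun _ _ h => by simpa using h⟩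
  have hprod (c : Coins n T d) : ∏ x, a x ^ sampleCount c t r k x =
      ∏ i, if i ∈ used then a (c.2.2 i) else 1 := by
    rw [Finset.prod_ite_mem, Finset.univ_inter, Finset.prod_map, ← Finset.prod_fiberwise _
      fun j => c.2.2 (t, r, j)]
    refine Finset.prod_congr rfl fun x _ => ?_
    rw [Finset.filter_filter, sampleCount]
    exact (Finset.prod_eq_pow_card fun j hj => congrArg a (Finset.mem_filter.1 hj).2.2).symm
  have hport (i) : ∫ y, (if i ∈ used then a y else 1) ∂(uniformOn (Set.univ : Set (Fin d))) =
      if i ∈ used then (∑ x, a x) / d else 1 := by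
    split_ifs
    · simp [integral_uniformOn_univ]
    · simp
  calc ∫ c, ∏ x, a x ^ sampleCount c t r k x ∂(coinLaw n T d)
      = ∫ p, ∏ i, (if i ∈ used then a (p i) else 1) ∂((coinLaw n T d).map fun c => c.2.2) := by
        rw [integral_map Measurable.of_discrete.aemeasurable .of_discrete]
        simp only [hprod]
    _ = ∏ i, if i ∈ used then (∑ x, a x) / d else 1 := by
        rw [map_ports_coinLaw, integral_fintype_prod_eq_prod
          fun i y => if i ∈ used then a y else 1]
        exact Finset.prod_congr rfl fun i _ => hport i
    _ = ((∑ x, a x) / d) ^ k := by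
        rw [Finset.prod_ite_mem, Finset.univ_inter, Finset.prod_const, Finset.card_map,
          Fin.card_filter_val_lt, min_eq_right hk]

end Law

/-! ### Independence of different supplies of random ports -/

section Resample

theorem measurePreserving_of_involutive {Ω : Type*} [Countable Ω] [MeasurableSpace Ω]
    [MeasurableSingletonClass Ω] {μ : Measure Ω} {e : Ω → Ω} (he : Function.Involutive e)
    (h : ∀ a, μ {e a} = μ {a}) : MeasurePreserving e μ μ := by
  refine ⟨.of_discrete, Measure.ext_of_singleton fun a => ?_⟩
  rw [Measure.map_apply .of_discrete (.singleton a), ← h a]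
  exact congrArg μ (Set.ext fun b => he.eq_iff)

variable {V : Type*} [Fintype V]

/-- The law of all private coins in the network. -/
noncomputable def outcomeLaw (G : SimpleGraph V) [DecidableRel G.Adj] (n T : ℕ) :
    Measure (Outcomes G n T) :=
  Measure.pi fun v => coinLaw n T (G.degree v)

variable {G : SimpleGraph V} [DecidableRel G.Adj] {n T : ℕ}

instance [NeZero n] [∀ v, NeZero (G.degree v)] : IsProbabilityMeasure (outcomeLaw G n T) := by
  unfold outcomeLaw
  infer_instance

open Classical in
/-- The outcome that has the random ports with index in `A` from `ω'`, and all other coins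
from `ω`. -/
noncomputable def resample (A : Set (Fin (T + 1) × Rank n × Fin (n * numTokens n)))
    (ω ω' : Outcomes G n T) : Outcomes G n T :=
  fun v => ((ω v).1, (ω v).2.1, fun i => if i ∈ A then (ω' v).2.2 i else (ω v).2.2 i)

variable (A : Set (Fin (T + 1) × Rank n × Fin (n * numTokens n)))

theorem resample_ports_of_mem (ω ω' : Outcomes G n T) (v : V)
    {i : Fin (T + 1) × Rank n × Fin (n * numTokens n)} (hi : i ∈ A) :
    (resample A ω ω' v).2.2 i = (ω' v).2.2 i :=
  if_pos hi

theorem resample_ports_of_notMem (ω ω' : Outcomes G n T) (v : V)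
    {i : Fin (T + 1) × Rank n × Fin (n * numTokens n)} (hi : i ∉ A) :
    (resample A ω ω' v).2.2 i = (ω v).2.2 i :=
  if_neg hi

/-- The exchange of the random ports with index in `A` between two outcomes. -/
noncomputable def exchange (p : Outcomes G n T × Outcomes G n T) :
    Outcomes G n T × Outcomes G n T :=
  (resample A p.1 p.2, resample A p.2 p.1)

theorem exchange_involutive : Function.Involutive (exchange (G := G) A) := by
  rintro ⟨ω, ω'⟩
  refine Prod.ext (funext fun v => ?_) (funext fun v => ?_) <;>
    refine Prod.ext rfl (Prod.ext rfl (funext fun i => ?_)) <;>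
    by_cases hi : i ∈ A <;> simp only [exchange, resample, hi, if_true, if_false]

variable [NeZero n] [∀ v, NeZero (G.degree v)]

theorem outcomeLaw_singleton_congr {ω ω' : Outcomes G n T} (h : ∀ v, (ω v).1 = (ω' v).1) :
    outcomeLaw G n T {ω} = outcomeLaw G n T {ω'} := by
  rw [outcomeLaw, Measure.pi_singleton, Measure.pi_singleton]
  exact Finset.prod_congr rfl fun v _ => coinLaw_singleton_congr (h v)

theorem measurePreserving_exchange : MeasurePreserving (exchange A)
    ((outcomeLaw G n T).prod (outcomeLaw G n T)) ((outcomeLaw G n T).prod (outcomeLaw G n T)) := by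
  refine measurePreserving_of_involutive (exchange_involutive A) ?_
  rintro ⟨ω, ω'⟩
  rw [exchange, ← Set.singleton_prod_singleton, ← Set.singleton_prod_singleton, Measure.prod_prod,
    Measure.prod_prod]
  congr 1 <;> exact outcomeLaw_singleton_congr fun _ => rfl

theorem integral_diag_eq {F : Outcomes G n T → Outcomes G n T → ℝ}
    (hF : ∀ ω ω', F (resample A ω ω') (resample A ω ω') = F ω ω') :
    ∫ ω, F ω ω ∂(outcomeLaw G n T) =
      ∫ ω, ∫ ω', F ω ω' ∂(outcomeLaw G n T) ∂(outcomeLaw G n T) :=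
  calc ∫ ω, F ω ω ∂(outcomeLaw G n T)
      = ∫ p, F p.1 p.1 ∂((outcomeLaw G n T).prod (outcomeLaw G n T)) := by
        simp only [integral_prod _ (Integrable.of_finite (f := fun p => F p.1 p.1)),
          integral_const, probReal_univ, one_smul]
    _ = ∫ p, F (exchange A p).1 (exchange A p).1
          ∂((outcomeLaw G n T).prod (outcomeLaw G n T)) := by
        conv_lhs => rw [← (measurePreserving_exchange A).map_eq]
        rw [integral_map (measurePreserving_exchange A).measurable.aemeasurable]
        exact Integrable.of_finite.aestronglyMeasurable
    _ = ∫ p, F p.1 p.2 ∂((outcomeLaw G n T).prod (outcomeLaw G n T)) :=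
        integral_congr_ae (.of_forall fun p => hF p.1 p.2)
    _ = ∫ ω, ∫ ω', F ω ω' ∂(outcomeLaw G n T) ∂(outcomeLaw G n T) :=
        integral_prod (fun p => F p.1 p.2) .of_finite

end Resample

/-! ### The endpoints of the undisturbed walks -/

section Walks

variable {V : Type*} [Fintype V] {G : SimpleGraph V} [DecidableRel G.Adj]
  (ports : PortNumbering G) {n T : ℕ}

theorem sum_ports_div_degree (f : V → ℝ) (v : V) :
    (∑ x, f (ports v x)) / G.degree v = (transitionMatrix G *ᵥ f) v := by
  rw [Equiv.sum_comp (ports v) fun w : G.neighborSet v => f w]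
  rw [← Finset.sum_subtype (G.neighborFinset v) (by simp) f, Finset.sum_div,
    SimpleGraph.neighborFinset_eq_filter, Finset.sum_filter]
  refine Finset.sum_congr rfl fun w _ => ?_
  simp only [transitionMatrix, ite_mul, one_div_mul_eq_div, zero_mul]

variable [DecidableEq V] [NeZero n] [∀ v, NeZero (G.degree v)]

theorem integral_prod_pow_walkCount_succ (r : Rank n) (u : V) {t : ℕ} (ht : t < T + 1)
    (f : V → ℝ) :
    ∫ ω, ∏ v, f v ^ walkCount ports ω r u (t + 1) v ∂(outcomeLaw G n T) =
      ∫ ω, ∏ v, (transitionMatrix G *ᵥ f) v ^ walkCount ports ω r u t v ∂(outcomeLaw G n T) := by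
  have hprod (ω : Outcomes G n T) : ∏ v, f v ^ walkCount ports ω r u (t + 1) v =
      ∏ w, ∏ x, f (ports w x) ^ sampleCount (ω w) ⟨t, ht⟩ r (walkCount ports ω r u t w) x := by
    simp only [walkCount_succ ports ω r u ht, ← Finset.prod_pow_eq_pow_sum]
    exact prod_reversePort ports fun v w x =>
      f v ^ sampleCount (ω w) ⟨t, ht⟩ r (walkCount ports ω r u t w) x
  simp only [hprod]
  rw [integral_diag_eq {i | i.1 = ⟨t, ht⟩} (F := fun ω ω' =>
    ∏ w, ∏ x, f (ports w x) ^ sampleCount (ω' w) ⟨t, ht⟩ r (walkCount ports ω r u t w) x)]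
  · refine integral_congr_ae (.of_forall fun ω => ?_)
    simp only [outcomeLaw]
    rw [integral_fintype_prod_eq_prod fun w c =>
      ∏ x, f (ports w x) ^ sampleCount c ⟨t, ht⟩ r (walkCount ports ω r u t w) x]
    refine Finset.prod_congr rfl fun w _ => ?_
    rw [integral_pow_sampleCount _ _ (walkCount_le ports ω r u (NeZero.pos n) ht.le w)
      fun x => f (ports w x), sum_ports_div_degree]
  · intro ω ω'
    have hwalk : walkCount ports (resample {i | i.1 = ⟨t, ht⟩} ω ω') r u t =
        walkCount ports ω r u t :=
      walkCount_congr ports r u fun v s hs j =>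
        resample_ports_of_notMem _ ω ω' v fun h => hs.ne (congrArg Fin.val h)
    simp only [hwalk, sampleCount]
    simp only [resample_ports_of_mem _ ω ω' _ (show (⟨t, ht⟩, r, _) ∈ {i | i.1 = ⟨t, ht⟩} from rfl)]

theorem integral_prod_pow_walkCount (r : Rank n) (u : V) {t : ℕ} (ht : t ≤ T + 1) (f : V → ℝ) :
    ∫ ω, ∏ v, f v ^ walkCount ports ω r u t v ∂(outcomeLaw G n T) =
      (transitionMatrix G ^ t *ᵥ f) u ^ numTokens n := by
  induction t generalizing f with
  | zero =>
    simp [walkCount, Pi.single_apply, Finset.prod_ite_eq', pow_ite]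
  | succ t ih =>
    rw [integral_prod_pow_walkCount_succ ports r u ht, ih (by omega), pow_succ,
      Matrix.mulVec_mulVec]

end Walks

section Meet

variable {V : Type*} [Fintype V] [DecidableEq V] {G : SimpleGraph V} [DecidableRel G.Adj]
  (ports : PortNumbering G) {n T : ℕ}

/-- The event that the undisturbed walks of `u` with rank `r` and of `v` with rank `r'` have no
common position at time `t`. -/
def separateWalks (r r' : Rank n) (u v : V) (t : ℕ) : Set (Outcomes G n T) :=
  {ω | ∀ w, walkCount ports ω r u t w = 0 ∨ walkCount ports ω r' v t w = 0}

theorem indicator_separateWalks (ω : Outcomes G n T) (r r' : Rank n) (u v : V) (t : ℕ) :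
    (separateWalks ports r r' u v t).indicator 1 ω =
      ∏ w with walkCount ports ω r u t w ≠ 0, (0 : ℝ) ^ walkCount ports ω r' v t w := by
  by_cases h : ∀ w, walkCount ports ω r u t w = 0 ∨ walkCount ports ω r' v t w = 0
  · rw [Set.indicator_of_mem (by exact h), Finset.prod_eq_one fun w hw => ?_, Pi.one_apply]
    rw [(h w).resolve_left (Finset.mem_filter.1 hw).2, pow_zero]
  · rw [Set.indicator_of_notMem (by exact h)]
    push Not at h
    obtain ⟨w, hw, hw'⟩ := h
    exact (Finset.prod_eq_zero (Finset.mem_filter.2 ⟨Finset.mem_univ w, hw⟩) (zero_pow hw')).symm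

variable [NeZero n] [∀ v, NeZero (G.degree v)]

theorem integral_prod_zero_pow_walkCount_le (r : Rank n) (u : V) {t : ℕ} (ht : t ≤ T + 1)
    {q : V → ℝ} (hq : ∀ w, q w ≤ (transitionMatrix G ^ t) u w) (S : Finset V) :
    ∫ ω, ∏ w ∈ S, (0 : ℝ) ^ walkCount ports ω r u t w ∂(outcomeLaw G n T) ≤
      ∏ w ∈ S, Real.exp (-(numTokens n * q w)) := by
  have hP : transitionMatrix G ^ t ∈ Matrix.rowStochastic ℝ V :=
    pow_mem (transitionMatrix_mem_rowStochastic fun v => NeZero.pos _) t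
  let f : V → ℝ := fun w => if w ∈ S then 0 else 1
  have hf : (transitionMatrix G ^ t *ᵥ f) u = 1 - ∑ w ∈ S, (transitionMatrix G ^ t) u w := by
    have hmul (w : V) : (transitionMatrix G ^ t) u w * f w =
        (transitionMatrix G ^ t) u w - if w ∈ S then (transitionMatrix G ^ t) u w else 0 := by
      by_cases hw : w ∈ S <;> simp [f, hw]
    simp only [Matrix.mulVec, dotProduct, hmul]
    rw [Finset.sum_sub_distrib, Matrix.sum_row_of_mem_rowStochastic hP, Finset.sum_ite_mem,
      Finset.univ_inter]
  have hf0 : 0 ≤ (transitionMatrix G ^ t *ᵥ f) u :=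
    Finset.sum_nonneg fun w _ => mul_nonneg (Matrix.nonneg_of_mem_rowStochastic hP)
      (by simp only [f]; split_ifs <;> norm_num)
  have hf1 : (transitionMatrix G ^ t *ᵥ f) u ≤ Real.exp (-∑ w ∈ S, q w) := by
    linarith [Real.add_one_le_exp (-∑ w ∈ S, q w), Finset.sum_le_sum fun w (_ : w ∈ S) => hq w]
  calc ∫ ω, ∏ w ∈ S, (0 : ℝ) ^ walkCount ports ω r u t w ∂(outcomeLaw G n T)
      = ∫ ω, ∏ w, f w ^ walkCount ports ω r u t w ∂(outcomeLaw G n T) := by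
        simp only [f, ite_pow, one_pow, Finset.prod_ite_mem, Finset.univ_inter]
    _ = (transitionMatrix G ^ t *ᵥ f) u ^ numTokens n :=
        integral_prod_pow_walkCount ports r u ht f
    _ ≤ Real.exp (-∑ w ∈ S, q w) ^ numTokens n := pow_le_pow_left₀ hf0 hf1 _
    _ = ∏ w ∈ S, Real.exp (-(numTokens n * q w)) := by
        rw [← Real.exp_nat_mul, ← Real.exp_sum, mul_neg, Finset.mul_sum, Finset.sum_neg_distrib]

theorem integral_prod_add_mul_zero_pow_walkCount_le (r : Rank n) (u : V) {t : ℕ} (ht : t ≤ T + 1)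
    {q e : V → ℝ} (hq : ∀ w, q w ≤ (transitionMatrix G ^ t) u w) (he : ∀ w, e w ∈ Set.Icc 0 1) :
    ∫ ω, ∏ w, ((1 - e w) * 0 ^ walkCount ports ω r u t w + e w) ∂(outcomeLaw G n T) ≤
      ∏ w, ((1 - e w) * Real.exp (-(numTokens n * q w)) + e w) := by
  have he0 (w : V) : 0 ≤ e w := (he w).1
  have he1 (w : V) : 0 ≤ 1 - e w := sub_nonneg.2 (he w).2
  simp only [Finset.prod_add, Finset.prod_mul_distrib]
  rw [integral_finsetSum _ fun _ _ => .of_finite]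
  refine Finset.sum_le_sum fun S _ => ?_
  rw [integral_mul_const, integral_const_mul]
  exact mul_le_mul_of_nonneg_right (mul_le_mul_of_nonneg_left
    (integral_prod_zero_pow_walkCount_le ports r u ht hq S)
    (Finset.prod_nonneg fun w _ => he1 w)) (Finset.prod_nonneg fun w _ => he0 w)

theorem measureReal_separateWalks_le {r r' : Rank n} (hr : r ≠ r') (u v : V) {t : ℕ}
    (ht : t ≤ T + 1) {q : V → ℝ} (hq0 : ∀ w, 0 ≤ q w)
    (hq : ∀ u w, q w ≤ (transitionMatrix G ^ t) u w) :
    (outcomeLaw G n T).real (separateWalks ports r r' u v t) ≤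
      ∏ w, ((1 - Real.exp (-(numTokens n * q w))) * Real.exp (-(numTokens n * q w)) +
        Real.exp (-(numTokens n * q w))) := by
  set e : V → ℝ := fun w => Real.exp (-(numTokens n * q w)) with he
  have hinner (ω : Outcomes G n T) :
      ∫ ω', ∏ w with walkCount ports ω r u t w ≠ 0, (0 : ℝ) ^ walkCount ports ω' r' v t w
        ∂(outcomeLaw G n T) ≤ ∏ w, ((1 - e w) * 0 ^ walkCount ports ω r u t w + e w) := by
    refine (integral_prod_zero_pow_walkCount_le ports r' v ht (hq v) _).trans_eq ?_
    rw [Finset.prod_filter]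
    refine Finset.prod_congr rfl fun w _ => ?_
    by_cases hw : walkCount ports ω r u t w = 0 <;> simp [hw, he]
  calc _ = ∫ ω, ∏ w with walkCount ports ω r u t w ≠ 0, (0 : ℝ) ^ walkCount ports ω r' v t w
        ∂(outcomeLaw G n T) := by
        rw [← integral_indicator_one (.of_discrete)]
        exact integral_congr_ae (.of_forall fun ω =>
          indicator_separateWalks ports ω r r' u v t)
    _ = ∫ ω, ∫ ω', ∏ w with walkCount ports ω r u t w ≠ 0, (0 : ℝ) ^ walkCount ports ω' r' v t w
        ∂(outcomeLaw G n T) ∂(outcomeLaw G n T) := by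
        refine integral_diag_eq {i | i.2.1 = r'} (F := fun ω ω' =>
          ∏ w with walkCount ports ω r u t w ≠ 0, (0 : ℝ) ^ walkCount ports ω' r' v t w)
          fun ω ω' => ?_
        rw [walkCount_congr ports r u (ω' := ω) fun v s _ j =>
            resample_ports_of_notMem _ ω ω' v hr,
          walkCount_congr ports r' v (ω' := ω') fun v s _ j =>
            resample_ports_of_mem _ ω ω' v rfl]
    _ ≤ ∫ ω, ∏ w, ((1 - e w) * 0 ^ walkCount ports ω r u t w + e w) ∂(outcomeLaw G n T) :=
        integral_mono .of_finite .of_finite hinner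
    _ ≤ _ := integral_prod_add_mul_zero_pow_walkCount_le ports r u ht (hq u) fun w =>
        ⟨(Real.exp_pos _).le, Real.exp_le_one_iff.2
          (neg_nonpos.2 (mul_nonneg (Nat.cast_nonneg _) (hq0 w)))⟩

end Meet

/-! ### The birthday estimate -/

section Birthday

theorem exp_neg_le_one_sub_half {a : ℝ} (h0 : 0 ≤ a) (h1 : a ≤ 1) : Real.exp (-a) ≤ 1 - a / 2 := by
  have h2 : Real.exp (-a) ≤ (a + 1)⁻¹ := by
    rw [Real.exp_neg]
    exact inv_anti₀ (by linarith) (Real.add_one_le_exp a)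
  refine h2.trans ((inv_le_iff_one_le_mul₀ (by linarith)).2 ?_)
  nlinarith

/-- The tangent `2 l a - l ^ 2 ≤ a ^ 2` makes the bound linear in `a`, so that the product over all
nodes depends only on the sum of the `a`. -/
theorem one_sub_exp_neg_mul_add_le {a l : ℝ} (ha : 0 ≤ a) (hl : l ≤ 1 / 2) :
    (1 - Real.exp (-a)) * Real.exp (-a) + Real.exp (-a) ≤
      Real.exp (-((2 * l * a - l ^ 2) / 4)) := by
  rcases le_total a 1 with h | h
  · calc (1 - Real.exp (-a)) * Real.exp (-a) + Real.exp (-a)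
        ≤ -(a ^ 2 / 4) + 1 := by nlinarith [exp_neg_le_one_sub_half ha h, Real.exp_pos (-a)]
      _ ≤ Real.exp (-(a ^ 2 / 4)) := Real.add_one_le_exp _
      _ ≤ Real.exp (-((2 * l * a - l ^ 2) / 4)) :=
        Real.exp_le_exp.2 (by nlinarith [sq_nonneg (a - l)])
  · have htwo : (2 : ℝ) ≤ Real.exp (3 / 4) := by
      rw [← Real.log_le_iff_le_exp (by norm_num)]
      linarith [Real.log_two_lt_d9]
    calc (1 - Real.exp (-a)) * Real.exp (-a) + Real.exp (-a)
        ≤ 2 * Real.exp (-a) := by nlinarith [Real.exp_pos (-a)]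
      _ ≤ Real.exp (3 / 4) * Real.exp (-a) := by gcongr
      _ = Real.exp (3 / 4 - a) := by rw [← Real.exp_add, sub_eq_add_neg]
      _ ≤ Real.exp (-((2 * l * a - l ^ 2) / 4)) := Real.exp_le_exp.2 (by nlinarith [sq_nonneg l])

theorem prod_one_sub_exp_neg_mul_add_le {ι : Type*} [Fintype ι] {a : ι → ℝ} {l : ℝ}
    (ha : ∀ i, 0 ≤ a i) (hl : l ≤ 1 / 2) :
    ∏ i, ((1 - Real.exp (-a i)) * Real.exp (-a i) + Real.exp (-a i)) ≤
      Real.exp ((Fintype.card ι * l ^ 2 - 2 * l * ∑ i, a i) / 4) := by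
  have hterm (i : ι) : 0 ≤ (1 - Real.exp (-a i)) * Real.exp (-a i) + Real.exp (-a i) := by
    have hle : Real.exp (-a i) ≤ 1 := Real.exp_le_one_iff.2 (neg_nonpos.2 (ha i))
    nlinarith [Real.exp_pos (-a i)]
  calc _ ≤ ∏ i, Real.exp (-((2 * l * a i - l ^ 2) / 4)) :=
        Finset.prod_le_prod (fun i _ => hterm i) fun i _ =>
          one_sub_exp_neg_mul_add_le (ha i) hl
    _ = Real.exp ((Fintype.card ι * l ^ 2 - 2 * l * ∑ i, a i) / 4) := by
        rw [← Real.exp_sum, Finset.sum_neg_distrib, ← Finset.sum_div, Finset.sum_sub_distrib,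
          ← Finset.mul_sum, Finset.sum_const, Finset.card_univ, nsmul_eq_mul]
        ring_nf

theorem two_mul_sqrt_le_numTokens (n : ℕ) : 2 * √(n * Real.log n) ≤ numTokens n := by
  rw [numTokens, Nat.cast_mul, Nat.cast_two]
  linarith [Nat.le_ceil √(n * Real.log n)]

theorem prod_one_sub_exp_neg_numTokens_mul_add_le {ι : Type*} [Fintype ι] [Nonempty ι] {n : ℕ}
    (hcard : Fintype.card ι = n) (hlog : 4 * Real.log n ≤ n) {q : ι → ℝ} (hq0 : ∀ i, 0 ≤ q i)
    (hq : 1 / 2 ≤ ∑ i, q i) :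
    ∏ i, ((1 - Real.exp (-(numTokens n * q i))) * Real.exp (-(numTokens n * q i)) +
        Real.exp (-(numTokens n * q i))) ≤ (n : ℝ) ^ (-(1 / 4) : ℝ) := by
  have hn : (0 : ℝ) < n := Nat.cast_pos.2 (hcard ▸ Fintype.card_pos)
  have hlog0 : 0 ≤ Real.log n := Real.log_natCast_nonneg n
  set l := √(Real.log n / n) with hl
  have hl0 : 0 ≤ l := Real.sqrt_nonneg _
  have hl_le : l ≤ 1 / 2 := by
    rw [hl, Real.sqrt_le_left (by norm_num), div_le_iff₀ hn]
    linarith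
  have hl_sq : l ^ 2 = Real.log n / n := Real.sq_sqrt (by positivity)
  have hl_mul : 2 * Real.log n ≤ l * numTokens n := by
    have hsqrt : l * √(n * Real.log n) = Real.log n := by
      rw [hl, ← Real.sqrt_mul (by positivity),
        show Real.log n / n * (n * Real.log n) = Real.log n ^ 2 by field_simp, Real.sqrt_sq hlog0]
    nlinarith [mul_le_mul_of_nonneg_left (two_mul_sqrt_le_numTokens n) hl0]
  refine (prod_one_sub_exp_neg_mul_add_le
    (fun i => mul_nonneg (Nat.cast_nonneg _) (hq0 i)) hl_le).trans ?_
  rw [Real.rpow_def_of_pos hn, hcard, hl_sq, mul_div_cancel₀ _ hn.ne', ← Finset.mul_sum]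
  refine Real.exp_le_exp.2 ?_
  nlinarith [mul_le_mul hl_mul hq (by norm_num) (by positivity)]

variable {V : Type*} [Fintype V] [DecidableEq V] {G : SimpleGraph V} [DecidableRel G.Adj]

theorem measureReal_separateWalks_mixingTime_le (ports : PortNumbering G)
    (hc : G.Connected) (hb : ¬ G.IsBipartite) {n : ℕ} (hcard : Fintype.card V = n)
    (hlog : 4 * Real.log n ≤ n) {r r' : Rank n} (hr : r ≠ r') (u v : V) :
    (outcomeLaw G n (mixingTime G)).real (separateWalks ports r r' u v (mixingTime G + 1)) ≤
      (n : ℝ) ^ (-(1 / 4) : ℝ) := by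
  have hV : Nonempty V := hc.nonempty
  have hdeg : ∀ v, 0 < G.degree v := degree_pos_of_not_isBipartite hc hb
  have : ∀ v, NeZero (G.degree v) := fun v => ⟨(hdeg v).ne'⟩
  have hn : 0 < n := hcard ▸ Fintype.card_pos
  have : NeZero n := ⟨hn.ne'⟩
  let q : V → ℝ := fun w => max (stationary G w - 1 / (2 * n)) 0
  have hq0 : ∀ w, 0 ≤ q w := fun w => le_max_right _ _
  have hq : ∀ x w, q w ≤ (transitionMatrix G ^ (mixingTime G + 1)) x w := by
    refine fun x w => max_le ?_ (Matrix.nonneg_of_mem_rowStochastic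
      (pow_mem (transitionMatrix_mem_rowStochastic hdeg) _))
    have hmix := abs_transitionMatrix_pow_sub_stationary_le hc hb x w
    rw [hcard] at hmix
    linarith [(abs_le.1 hmix).1]
  have hsum : 1 / 2 ≤ ∑ w, q w :=
    calc (1 : ℝ) / 2 = ∑ w, (stationary G w - 1 / (2 * n)) := by
          rw [Finset.sum_sub_distrib, (stationary_mem_stdSimplex hdeg).2, Finset.sum_const,
            Finset.card_univ, hcard, nsmul_eq_mul]
          field_simp
          norm_num
      _ ≤ ∑ w, q w := Finset.sum_le_sum fun w _ => le_max_left _ _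
  exact (measureReal_separateWalks_le ports hr u v le_rfl hq0 hq).trans
    (prod_one_sub_exp_neg_numTokens_mul_add_le hcard hlog hq0 hsum)

end Birthday

/-! ### The probability of a successful election -/

section GoodSet

variable {V : Type*} [Fintype V] [DecidableEq V] {G : SimpleGraph V} [DecidableRel G.Adj]
  {n T : ℕ} (ports : PortNumbering G)

/-- Outcomes for which the election succeeds with few messages. The bound on the number of
candidates is four times its mean. -/
def goodSet : Set (Outcomes G n T) :=
  {ω | Good ports ω ∧ (numCandidates ω : ℝ) ≤ 8 * Real.log n}

theorem compl_goodSet_subset : (goodSet ports : Set (Outcomes G n T))ᶜ ⊆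
    {ω | ∀ v, (ω v).1 = false} ∪ {ω | 8 * Real.log n < numCandidates ω} ∪
      (⋃ p ∈ (Finset.univ : Finset V).offDiag, {ω | (ω p.1).2.1 = (ω p.2).2.1}) ∪
      ⋃ p ∈ (Finset.univ : Finset V).offDiag,
        {ω | ((ω p.1).1 = true ∧ (ω p.2).1 = true) ∧ (ω p.1).2.1 ≠ (ω p.2).2.1 ∧
          ω ∈ separateWalks ports (ω p.1).2.1 (ω p.2).2.1 p.1 p.2 (T + 1)} := by
  intro ω hω
  contrapose! hω
  simp only [Set.mem_union, Set.mem_iUnion, Set.mem_ofPred_eq, not_or, not_exists, Finset.mem_univ,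
    Finset.mem_offDiag, true_and, Prod.forall, not_and, not_forall, not_lt, Bool.not_eq_false] at hω
  obtain ⟨⟨⟨hcand, hfew⟩, hrank⟩, hmeet⟩ := hω
  rw [Set.mem_compl_iff, not_not]
  refine ⟨⟨hcand, fun u v _ _ h => ?_, fun u v hu hv huv => ?_⟩, hfew⟩
  · by_contra huv
    exact hrank u v huv h
  · simpa [separateWalks, Nat.pos_iff_ne_zero] using hmeet u v huv ⟨hu, hv⟩ (hrank u v huv)

end GoodSet

section Success

open ProbabilityTheory

theorem measureReal_biUnion_offDiag_le {Ω ι : Type*} [MeasurableSpace Ω] {μ : Measure Ω}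
    [Fintype ι] {f : ι × ι → Set Ω} {b : ℝ} (hb : 0 ≤ b)
    (hf : ∀ p, p.1 ≠ p.2 → μ.real (f p) ≤ b) :
    μ.real (⋃ p ∈ (Finset.univ : Finset ι).offDiag, f p) ≤ Fintype.card ι ^ 2 * b := by
  classical
  refine (measureReal_biUnion_finset_le _ _).trans ((Finset.sum_le_card_nsmul _ _ b fun p hp =>
    hf p (Finset.mem_offDiag.1 hp).2.2).trans ?_)
  rw [nsmul_eq_mul, Finset.offDiag_card, Finset.card_univ, pow_two, ← Nat.cast_mul]
  gcongr
  exact Nat.sub_le _ _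

variable {V : Type*} [Fintype V] {G : SimpleGraph V} [DecidableRel G.Adj] {n T : ℕ}
  [NeZero n] [∀ v, NeZero (G.degree v)]

theorem measureReal_forall_candidate_eq (b : V → Bool) :
    (outcomeLaw G n T).real {ω | ∀ v, (ω v).1 = b v} = ∏ v, (candidateLaw n).real {b v} := by
  have hset : {ω : Outcomes G n T | ∀ v, (ω v).1 = b v} =
      Set.univ.pi fun v => Prod.fst ⁻¹' {b v} := by
    ext ω
    simp
  rw [hset, outcomeLaw, measureReal_def, Measure.pi_pi, ENNReal.toReal_prod]
  refine Finset.prod_congr rfl fun v _ => ?_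
  rw [← map_fst_coinLaw (T := T) (d := G.degree v), measureReal_def,
    Measure.map_apply measurable_fst .of_discrete]

theorem measureReal_pair_mem {u v : V} (huv : u ≠ v) (A : Set (Coins n T (G.degree u)))
    (B : Set (Coins n T (G.degree v))) :
    (outcomeLaw G n T).real {ω | ω u ∈ A ∧ ω v ∈ B} =
      (coinLaw n T (G.degree u)).real A * (coinLaw n T (G.degree v)).real B := by
  have hindep : IndepFun (fun ω : Outcomes G n T => ω u) (fun ω => ω v) (outcomeLaw G n T) :=
    (iIndepFun_pi (X := fun _ c => c) fun _ => aemeasurable_id).indepFun huv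
  have heval (w : V) (C : Set (Coins n T (G.degree w))) :
      outcomeLaw G n T ((fun ω => ω w) ⁻¹' C) = coinLaw n T (G.degree w) C :=
    (measurePreserving_eval (fun w => coinLaw n T (G.degree w)) w).measure_preimage
      MeasurableSet.of_discrete.nullMeasurableSet
  have hinter := hindep.measure_inter_preimage_eq_mul A B .of_discrete .of_discrete
  rw [heval, heval] at hinter
  simp only [measureReal_def, ← ENNReal.toReal_mul, ← hinter]
  rfl

theorem measureReal_candidate_and_candidate {u v : V} (huv : u ≠ v) :
    (outcomeLaw G n T).real {ω | (ω u).1 = true ∧ (ω v).1 = true} = candProb n ^ 2 := by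
  have hcoin (w : V) :
      (coinLaw n T (G.degree w)).real {c | c.1 = true} = candProb n := by
    rw [← candidateLaw_real_true, ← map_fst_coinLaw (T := T) (d := G.degree w),
      map_measureReal_apply measurable_fst .of_discrete]
    rfl
  rw [pow_two]
  exact (measureReal_pair_mem huv {c | c.1 = true} {c | c.1 = true}).trans
    (congrArg₂ _ (hcoin u) (hcoin v))

theorem measureReal_rank_eq_rank_le {u v : V} (huv : u ≠ v) :
    (outcomeLaw G n T).real {ω | (ω u).2.1 = (ω v).2.1} ≤ ((n : ℝ) ^ 4)⁻¹ := by
  have hcoin (w : V) (r : Rank n) :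
      (coinLaw n T (G.degree w)).real {c | c.2.1 = r} = ((n : ℝ) ^ 4)⁻¹ := by
    have hrank := uniformOn_univ_real_singleton r
    rwa [card_rank, Nat.cast_pow, ← map_rank_coinLaw (T := T) (d := G.degree w),
      map_measureReal_apply .of_discrete .of_discrete] at hrank
  have hn : (n : ℝ) ^ 4 ≠ 0 := pow_ne_zero _ (NeZero.ne _)
  calc (outcomeLaw G n T).real {ω | (ω u).2.1 = (ω v).2.1}
      = (outcomeLaw G n T).real (⋃ r, {ω | (ω u).2.1 = r ∧ (ω v).2.1 = r}) := by
        congr 1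
        ext ω
        simp only [Set.mem_iUnion, Set.mem_ofPred_eq]
        exact ⟨fun h => ⟨_, h, rfl⟩, fun ⟨r, hu, hv⟩ => hu.trans hv.symm⟩
    _ ≤ ∑ r, (outcomeLaw G n T).real {ω | (ω u).2.1 = r ∧ (ω v).2.1 = r} :=
        measureReal_iUnion_fintype_le _
    _ = ∑ _r : Rank n, ((n : ℝ) ^ 4)⁻¹ * ((n : ℝ) ^ 4)⁻¹ := Finset.sum_congr rfl fun r _ =>
        (measureReal_pair_mem huv {c | c.2.1 = r} {c | c.2.1 = r}).trans
          (congrArg₂ _ (hcoin u r) (hcoin v r))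
    _ = ((n : ℝ) ^ 4)⁻¹ := by
        rw [Finset.sum_const, Finset.card_univ, card_rank, nsmul_eq_mul, Nat.cast_pow,
          mul_inv_cancel_left₀ hn]

theorem measureReal_no_candidate_le (hcard : Fintype.card V = n) :
    (outcomeLaw G n T).real {ω | ∀ v, (ω v).1 = false} ≤ ((n : ℝ) ^ 2)⁻¹ := by
  have hn : (0 : ℝ) < n := Nat.cast_pos.2 (NeZero.pos n)
  calc (outcomeLaw G n T).real {ω | ∀ v, (ω v).1 = false}
      = (1 - candProb n) ^ n := by
        rw [measureReal_forall_candidate_eq, Finset.prod_const, Finset.card_univ, hcard,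
          candidateLaw_real_false]
    _ ≤ Real.exp (-candProb n) ^ n := by
        refine pow_le_pow_left₀ (sub_nonneg.2 (candProb_lt_one n).le) ?_ _
        exact Real.one_sub_le_exp_neg _
    _ = Real.exp (-(Real.log n * 2)) := by
        rw [← Real.exp_nat_mul, candProb]
        field_simp
    _ = ((n : ℝ) ^ 2)⁻¹ := by
        rw [Real.exp_neg, Real.exp_mul, Real.exp_log hn, Real.rpow_two]

theorem integral_two_pow_numCandidates_le (hcard : Fintype.card V = n) :
    ∫ ω, (2 : ℝ) ^ numCandidates ω ∂(outcomeLaw G n T) ≤ (n : ℝ) ^ 2 := by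
  have hn : (0 : ℝ) < n := Nat.cast_pos.2 (NeZero.pos n)
  let weight : Bool → ℝ := fun b => if b = true then 2 else 1
  have hcoin (v : V) :
      ∫ c, weight c.1 ∂(coinLaw n T (G.degree v)) = 1 + candProb n := by
    calc ∫ c, weight c.1 ∂(coinLaw n T (G.degree v)) = ∫ b, weight b ∂(candidateLaw n) := by
          rw [← map_fst_coinLaw (T := T) (d := G.degree v),
            integral_map measurable_fst.aemeasurable .of_discrete]
      _ = 1 + candProb n := by
          rw [integral_fintype .of_finite, Fintype.sum_bool, candidateLaw_real_true,
            candidateLaw_real_false]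
          simp only [weight, if_true, Bool.false_eq_true, if_false, smul_eq_mul]
          ring
  calc ∫ ω, (2 : ℝ) ^ numCandidates ω ∂(outcomeLaw G n T)
      = ∫ ω, ∏ v, weight (ω v).1 ∂(outcomeLaw G n T) := by
        simp only [numCandidates, weight, ← Finset.prod_filter, Finset.prod_const]
    _ = (1 + candProb n) ^ n := by
        rw [outcomeLaw, integral_fintype_prod_eq_prod fun v (c : Coins n T (G.degree v)) =>
          weight c.1, Finset.prod_congr rfl fun v _ => hcoin v, Finset.prod_const,
          Finset.card_univ, hcard]
    _ ≤ Real.exp (candProb n) ^ n := by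
        refine pow_le_pow_left₀ (by linarith [candProb_nonneg n]) ?_ _
        linarith [Real.add_one_le_exp (candProb n)]
    _ = Real.exp (Real.log n * 2) := by
        rw [← Real.exp_nat_mul, candProb]
        field_simp
    _ = (n : ℝ) ^ 2 := by rw [Real.exp_mul, Real.exp_log hn, Real.rpow_two]

theorem measureReal_numCandidates_gt_le (hcard : Fintype.card V = n) :
    (outcomeLaw G n T).real {ω | 8 * Real.log n < numCandidates ω} ≤ ((n : ℝ) ^ 2)⁻¹ := by
  have hn : (0 : ℝ) < n := Nat.cast_pos.2 (NeZero.pos n)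
  have hsub : {ω : Outcomes G n T | 8 * Real.log n < numCandidates ω} ⊆
      {ω | (n : ℝ) ^ 4 ≤ 2 ^ numCandidates ω} := by
    intro ω hω
    rw [Set.mem_ofPred_eq] at hω ⊢
    rw [← Real.rpow_natCast, ← Real.rpow_natCast, Real.rpow_def_of_pos hn,
      Real.rpow_def_of_pos two_pos, Real.exp_le_exp]
    push_cast
    nlinarith [Real.log_two_gt_d9, Real.log_natCast_nonneg n]
  have hmarkov := mul_meas_ge_le_integral_of_nonneg (μ := outcomeLaw G n T)
    (.of_forall fun ω => by positivity)
    (Integrable.of_finite (f := fun ω => (2 : ℝ) ^ numCandidates ω)) ((n : ℝ) ^ 4)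
  calc (outcomeLaw G n T).real {ω | 8 * Real.log n < numCandidates ω}
      ≤ (outcomeLaw G n T).real {ω | (n : ℝ) ^ 4 ≤ 2 ^ numCandidates ω} :=
        measureReal_mono hsub
    _ ≤ (n : ℝ) ^ 2 / n ^ 4 := by
        rw [le_div_iff₀' (by positivity)]
        exact hmarkov.trans (integral_two_pow_numCandidates_le hcard)
    _ = ((n : ℝ) ^ 2)⁻¹ := by field_simp

variable [DecidableEq V] (ports : PortNumbering G)

theorem measureReal_candidates_separate_le {u v : V} (huv : u ≠ v) {β : ℝ} (hβ0 : 0 ≤ β)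
    (hβ : ∀ r r' : Rank n, r ≠ r' →
      (outcomeLaw G n T).real (separateWalks ports r r' u v (T + 1)) ≤ β) :
    (outcomeLaw G n T).real {ω | ((ω u).1 = true ∧ (ω v).1 = true) ∧ (ω u).2.1 ≠ (ω v).2.1 ∧
      ω ∈ separateWalks ports (ω u).2.1 (ω v).2.1 u v (T + 1)} ≤ candProb n ^ 2 * β := by
  let E : Set (Outcomes G n T) := {ω | (ω u).1 = true ∧ (ω v).1 = true}
  let R : Set (Outcomes G n T) := {ω | (ω u).2.1 ≠ (ω v).2.1}
  let F (ω ω' : Outcomes G n T) : ℝ := (E ∩ R).indicator 1 ω *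
    (separateWalks ports (ω u).2.1 (ω v).2.1 u v (T + 1)).indicator 1 ω'
  have hinner (ω : Outcomes G n T) :
      ∫ ω', F ω ω' ∂(outcomeLaw G n T) ≤ E.indicator 1 ω * β := by
    rw [integral_const_mul, integral_indicator_one .of_discrete]
    by_cases hE : ω ∈ E <;> by_cases hR : ω ∈ R
    · simpa [hE, hR] using hβ _ _ hR
    · simpa [hE, hR] using hβ0
    · simp [hE]
    · simp [hE]
  calc _ = ∫ ω, F ω ω ∂(outcomeLaw G n T) := by
        rw [← integral_indicator_one .of_discrete]
        refine integral_congr_ae (.of_forall fun ω => ?_)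
        by_cases hE : ω ∈ E <;> by_cases hR : ω ∈ R <;>
          by_cases hS : ω ∈ separateWalks ports (ω u).2.1 (ω v).2.1 u v (T + 1) <;>
          simp_all [F, E, R]
    _ = ∫ ω, ∫ ω', F ω ω' ∂(outcomeLaw G n T) ∂(outcomeLaw G n T) := by
        refine integral_diag_eq Set.univ fun ω ω' => ?_
        have hwalk (r : Rank n) (w : V) :
            walkCount ports (resample Set.univ ω ω') r w = walkCount ports ω' r w :=
          funext fun t => walkCount_congr ports r w fun x s _ j =>
            resample_ports_of_mem _ ω ω' x (Set.mem_univ _)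
        have hind (r r' : Rank n) :
            (separateWalks ports r r' u v (T + 1)).indicator (1 : Outcomes G n T → ℝ)
              (resample Set.univ ω ω') =
              (separateWalks ports r r' u v (T + 1)).indicator 1 ω' := by
          simp only [Set.indicator_apply, separateWalks, Set.mem_ofPred_eq, hwalk, Pi.one_apply]
        exact congrArg ((E ∩ R).indicator 1 ω * ·) (hind (ω u).2.1 (ω v).2.1)
    _ ≤ ∫ ω, E.indicator 1 ω * β ∂(outcomeLaw G n T) :=
        integral_mono .of_finite .of_finite hinner
    _ = candProb n ^ 2 * β := by
        rw [integral_mul_const, integral_indicator_one .of_discrete,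
          measureReal_candidate_and_candidate huv]

theorem one_sub_le_measureReal_goodSet (hcard : Fintype.card V = n) {β : ℝ} (hβ0 : 0 ≤ β)
    (hβ : ∀ (u v : V) (r r' : Rank n), r ≠ r' →
      (outcomeLaw G n T).real (separateWalks ports r r' u v (T + 1)) ≤ β) :
    1 - (3 * ((n : ℝ) ^ 2)⁻¹ + 4 * Real.log n ^ 2 * β) ≤
      (outcomeLaw G n T).real (goodSet ports) := by
  have hn : (n : ℝ) ≠ 0 := NeZero.ne _
  have hrank := measureReal_biUnion_offDiag_le (μ := outcomeLaw G n T)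
    (f := fun p => {ω | (ω p.1).2.1 = (ω p.2).2.1}) (by positivity)
    fun p hp => measureReal_rank_eq_rank_le hp
  have hseparate := measureReal_biUnion_offDiag_le (mul_nonneg (sq_nonneg (candProb n)) hβ0)
    fun p hp => measureReal_candidates_separate_le ports hp hβ0 (hβ p.1 p.2)
  rw [hcard] at hrank hseparate
  have hrank_eq : (n : ℝ) ^ 2 * ((n : ℝ) ^ 4)⁻¹ = ((n : ℝ) ^ 2)⁻¹ := by field_simp
  have hseparate_eq : (n : ℝ) ^ 2 * (candProb n ^ 2 * β) = 4 * Real.log n ^ 2 * β := by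
    rw [candProb]
    field_simp
    ring
  have hcompl := (measureReal_mono (μ := outcomeLaw G n T) (compl_goodSet_subset ports)).trans <|
    (measureReal_union_le _ _).trans <| add_le_add_left
      ((measureReal_union_le _ _).trans <| add_le_add_left (measureReal_union_le _ _) _) _
  rw [probReal_compl_eq_one_sub .of_discrete] at hcompl
  linarith [measureReal_no_candidate_le (G := G) (T := T) hcard,
    measureReal_numCandidates_gt_le (G := G) (T := T) hcard]

theorem mul_pow_le_measureReal_goodSet (hcard : Fintype.card V = n) (hlog : 1 ≤ Real.log n) :
    candProb n * (1 - candProb n) ^ (n - 1) ≤ (outcomeLaw G n T).real (goodSet ports) := by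
  obtain ⟨u⟩ : Nonempty V := Fintype.card_pos_iff.1 (hcard ▸ NeZero.pos n)
  have hsub : {ω : Outcomes G n T | ∀ v, (ω v).1 = decide (v = u)} ⊆ goodSet ports := by
    intro ω hω
    have hcand (v : V) : (ω v).1 = true ↔ v = u := by rw [hω v, decide_eq_true_iff]
    refine ⟨⟨⟨u, (hcand u).2 rfl⟩, fun x y hx hy _ => ?_, fun x y hx hy hxy => ?_⟩, ?_⟩
    · rw [(hcand x).1 hx, (hcand y).1 hy]
    · exact absurd (((hcand x).1 hx).trans ((hcand y).1 hy).symm) hxy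
    · have hone : numCandidates ω = 1 := by
        simp only [numCandidates, hcand, Finset.filter_eq', Finset.mem_univ, if_true,
          Finset.card_singleton]
      rw [hone, Nat.cast_one]
      linarith
  calc candProb n * (1 - candProb n) ^ (n - 1)
      = ∏ v, (candidateLaw n).real {decide (v = u)} := by
        rw [← Finset.mul_prod_erase _ _ (Finset.mem_univ u), decide_eq_true rfl,
          candidateLaw_real_true, Finset.prod_congr rfl (g := fun _ => 1 - candProb n),
          Finset.prod_const, Finset.card_erase_of_mem (Finset.mem_univ u), Finset.card_univ, hcard]
        intro v hv
        rw [decide_eq_false (Finset.ne_of_mem_erase hv), candidateLaw_real_false]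
    _ = (outcomeLaw G n T).real {ω | ∀ v, (ω v).1 = decide (v = u)} :=
        (measureReal_forall_candidate_eq _).symm
    _ ≤ (outcomeLaw G n T).real (goodSet ports) := measureReal_mono hsub

end Success

/-! ### Asymptotics -/

section Asymptotics

variable {n : ℕ}

theorem one_lt_log_of_three_le (hn : 3 ≤ n) : 1 < Real.log n := by
  have hn' : (3 : ℝ) ≤ n := by exact_mod_cast hn
  rw [Real.lt_log_iff_exp_lt (by positivity)]
  linarith [Real.exp_one_lt_d9]

theorem numTokens_le_four_mul_sqrt (hn : 3 ≤ n) :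
    (numTokens n : ℝ) ≤ 4 * √(n * Real.log n) := by
  have hn' : (3 : ℝ) ≤ n := by exact_mod_cast hn
  have hsqrt : 1 ≤ √(n * Real.log n) := by
    rw [Real.one_le_sqrt]
    nlinarith [one_lt_log_of_three_le hn]
  rw [numTokens, Nat.cast_mul, Nat.cast_two]
  linarith [Nat.ceil_lt_add_one (Real.sqrt_nonneg (n * Real.log n))]

theorem numTokens_le_two_mul (n : ℕ) : numTokens n ≤ 2 * n := by
  refine Nat.mul_le_mul_left 2 (Nat.ceil_le.2 ?_)
  rw [Real.sqrt_le_left (by positivity), sq]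
  exact mul_le_mul_of_nonneg_left (Real.log_le_self (by positivity)) (by positivity)

theorem length_bits_le_of_lt_pow (hn : 3 ≤ n) {m k : ℕ} (hm : m < n ^ k) :
    ((Nat.bits m).length : ℝ) ≤ (2 * k + 1) * Real.log n := by
  have hlog := one_lt_log_of_three_le hn
  rw [Nat.size_eq_bits_len]
  rcases m.size.eq_zero_or_pos with hsize | hsize
  · rw [hsize, Nat.cast_zero]
    positivity
  have hpow : (2 : ℝ) ^ (m.size - 1) ≤ (n : ℝ) ^ k := by
    exact_mod_cast (Nat.lt_size.1 (Nat.sub_one_lt_of_lt hsize)).trans hm.le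
  have hlog_le : (m.size - 1) * Real.log 2 ≤ k * Real.log n := by
    have h := Real.log_le_log (by positivity) hpow
    rwa [Real.log_pow, Real.log_pow, Nat.cast_sub hsize, Nat.cast_one] at h
  have hsize' : (1 : ℝ) ≤ m.size := by exact_mod_cast hsize
  nlinarith [Real.log_two_gt_d9]

theorem two_mul_pair_add_one_lt (hn : 3 ≤ n) (r : Rank n) {k : ℕ} (hk : k ≤ n * numTokens n) :
    2 * Nat.pair r.1 k + 1 < n ^ 11 := by
  have hk' : k ≤ n ^ 4 :=
    calc k ≤ n * (2 * n) := hk.trans (Nat.mul_le_mul_left n (numTokens_le_two_mul n))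
      _ ≤ n * (n * n) := by gcongr; omega
      _ = n ^ 3 := by ring
      _ ≤ n ^ 4 := Nat.pow_le_pow_right (by omega) (by norm_num)
  have hpair : Nat.pair r.1 k < n ^ 10 :=
    calc Nat.pair r.1 k < (max r.1 k + 1) ^ 2 := Nat.pair_lt_max_add_one_sq _ _
      _ ≤ (n ^ 4 + 1) ^ 2 := by
          gcongr
          exact max_le r.2.2 hk'
      _ ≤ (n ^ 4 * n) ^ 2 := by
          gcongr
          nlinarith [Nat.one_le_pow 4 n (by omega)]
      _ = n ^ 10 := by ring
  calc 2 * Nat.pair r.1 k + 1 < 2 * n ^ 10 := by omega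
    _ ≤ n * n ^ 10 := by gcongr; omega
    _ = n ^ 11 := by ring

theorem exists_forall_le_rpow_neg (s : ℕ → ℝ) (S : Finset ℕ) (hS : ∀ n ∈ S, n ≠ 0 ∧ s n < 1)
    {b : ℝ} (hb : 0 < b) : ∃ c ∈ Set.Ioc 0 b, ∀ n ∈ S, s n ≤ (n : ℝ) ^ (-c) := by
  have hev : ∀ n ∈ S, ∀ᶠ c in nhdsWithin (0 : ℝ) (Set.Ioi 0), s n ≤ (n : ℝ) ^ (-c) := by
    intro n hn
    have hcont : Continuous fun c : ℝ => (n : ℝ) ^ (-c) :=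
      continuous_const.rpow continuous_neg fun _ => Or.inl (Nat.cast_ne_zero.2 (hS n hn).1)
    have hlim : Tendsto (fun c : ℝ => (n : ℝ) ^ (-c)) (nhds 0) (nhds 1) := by
      simpa using hcont.tendsto 0
    exact (hlim.eventually (eventually_ge_nhds (hS n hn).2)).filter_mono nhdsWithin_le_nhds
  obtain ⟨c, hc, hcb⟩ := ((eventually_all_finset S).2 hev |>.and (Ioc_mem_nhdsGT hb)).exists
  exact ⟨c, hcb, hc⟩

theorem eventually_four_mul_log_le : ∀ᶠ x : ℝ in atTop, 4 * Real.log x ≤ x := by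
  filter_upwards [Real.isLittleO_log_id_atTop.bound (show (0 : ℝ) < 1 / 4 by norm_num),
    eventually_ge_atTop 1] with x hx hx1
  rw [Real.norm_of_nonneg (Real.log_nonneg hx1), id, Real.norm_of_nonneg (by linarith)] at hx
  linarith

theorem eventually_failure_bound_le : ∀ᶠ x : ℝ in atTop,
    3 * (x ^ 2)⁻¹ + 4 * Real.log x ^ 2 * x ^ (-(1 / 4) : ℝ) ≤ x ^ (-(1 / 8) : ℝ) := by
  have hlog := (isLittleO_log_rpow_rpow_atTop (2 : ℝ) (show (0 : ℝ) < 1 / 8 by norm_num)).bound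
    (show (0 : ℝ) < 1 / 8 by norm_num)
  have hpow := (tendsto_rpow_neg_atTop (show (0 : ℝ) < 15 / 8 by norm_num)).eventually
    (eventually_le_nhds (show (0 : ℝ) < 1 / 6 by norm_num))
  filter_upwards [hlog, hpow, eventually_ge_atTop 1] with x hlog hpow hx
  have hx0 : 0 < x := by linarith
  rw [Real.rpow_two, Real.norm_of_nonneg (by positivity),
    Real.norm_of_nonneg (by positivity)] at hlog
  have hsplit : (x ^ 2)⁻¹ = x ^ (-(15 / 8) : ℝ) * x ^ (-(1 / 8) : ℝ) := by
    rw [← Real.rpow_add hx0, ← Real.rpow_two, ← Real.rpow_neg hx0.le]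
    norm_num
  have hmerge : x ^ (1 / 8 : ℝ) * x ^ (-(1 / 4) : ℝ) = x ^ (-(1 / 8) : ℝ) := by
    rw [← Real.rpow_add hx0]
    norm_num
  calc 3 * (x ^ 2)⁻¹ + 4 * Real.log x ^ 2 * x ^ (-(1 / 4) : ℝ)
      ≤ 3 * (1 / 6 * x ^ (-(1 / 8) : ℝ)) +
          4 * (1 / 8 * x ^ (1 / 8 : ℝ)) * x ^ (-(1 / 4) : ℝ) := by
        rw [hsplit]
        gcongr
    _ = x ^ (-(1 / 8) : ℝ) := by
        linear_combination (1 / 2) * hmerge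

end Asymptotics

theorem exists_one_sub_rpow_neg_le_measureReal_goodSet : ∃ c : ℝ, 0 < c ∧
    ∀ (V : Type*) [Fintype V] [DecidableEq V] (G : SimpleGraph V) [DecidableRel G.Adj]
      (ports : PortNumbering G), G.Connected → ¬ G.IsBipartite →
      1 - (Fintype.card V : ℝ) ^ (-c) ≤
        (outcomeLaw G (Fintype.card V) (mixingTime G)).real (goodSet ports) := by
  obtain ⟨N, hN⟩ := eventually_atTop.1 (tendsto_natCast_atTop_atTop.eventually
    (eventually_four_mul_log_le.and eventually_failure_bound_le))
  obtain ⟨c, ⟨hc0, hc8⟩, hsmall⟩ := exists_forall_le_rpow_neg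
    (fun n => 1 - candProb n * (1 - candProb n) ^ (n - 1)) (Finset.Ico 3 N) (fun n hn => by
      have h3 : 3 ≤ n := (Finset.mem_Ico.1 hn).1
      exact ⟨by omega, sub_lt_self _ (mul_pos (candProb_pos (by omega))
        (pow_pos (sub_pos.2 (candProb_lt_one n)) _))⟩) (show (0 : ℝ) < 1 / 8 by norm_num)
  refine ⟨c, hc0, fun V _ _ G _ ports hc hb => ?_⟩
  have h3 : 3 ≤ Fintype.card V := three_le_card_of_not_isBipartite hb
  have : NeZero (Fintype.card V) := ⟨by omega⟩
  have : ∀ v, NeZero (G.degree v) := fun v => ⟨(degree_pos_of_not_isBipartite hc hb v).ne'⟩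
  rcases lt_or_ge (Fintype.card V) N with hlt | hge
  · have hsingle := mul_pow_le_measureReal_goodSet (T := mixingTime G) ports rfl
      (one_lt_log_of_three_le h3).le
    linarith [hsmall _ (Finset.mem_Ico.2 ⟨h3, hlt⟩)]
  · obtain ⟨hlog, hfail⟩ := hN _ hge
    have hlarge := one_sub_le_measureReal_goodSet (T := mixingTime G) ports rfl (by positivity)
      fun u v r r' hr => measureReal_separateWalks_mixingTime_le ports hc hb rfl hlog hr u v
    have hexp : (Fintype.card V : ℝ) ^ (-(1 / 8) : ℝ) ≤ (Fintype.card V : ℝ) ^ (-c) :=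
      Real.rpow_le_rpow_of_exponent_le (by exact_mod_cast NeZero.one_le) (neg_le_neg hc8)
    linarith

section Main

variable {V : Type*} [Fintype V] [DecidableEq V] {G : SimpleGraph V} [DecidableRel G.Adj]
  (ports : PortNumbering G)

theorem messageSizeLE (hb : ¬ G.IsBipartite) (pick : PortChoice) :
    (algorithmOn G pick).MessageSizeLE ports (128 * Real.log (Fintype.card V)) := by
  intro ω t v x m hm
  have h3 : 3 ≤ Fintype.card V := three_le_card_of_not_isBipartite hb
  obtain ⟨r, k, hk, hcode⟩ := exists_code_sentAt_le ports pick ω hm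
  refine (length_bits_le_of_lt_pow h3 (hcode.trans_lt (two_mul_pair_add_one_lt h3 r hk))).trans ?_
  push_cast
  linarith [one_lt_log_of_three_le h3]

theorem two_mul_mixingTime_add_one_le (hc : G.Connected) (hb : ¬ G.IsBipartite) {t : ℕ}
    (ht : 128 * (mixingTime G : ℝ) ≤ t) : 2 * (mixingTime G + 1) ≤ t := by
  have hT := mixingTime_pos hc hb
  have ht' : 128 * mixingTime G ≤ t := by exact_mod_cast ht
  omega

theorem haltsWithin (hc : G.Connected) (hb : ¬ G.IsBipartite) (pick : PortChoice) :
    (algorithmOn G pick).HaltsWithin ports (128 * mixingTime G) := by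
  intro ω t ht v
  have ht' := two_mul_mixingTime_add_one_le hc hb ht
  exact ⟨sentAt_eq_none ports pick ω ht' v, congrArg State.status
    ((stateAt_of_two_mul_le ports pick ω (ht'.trans t.le_succ) v).trans
      (stateAt_of_two_mul_le ports pick ω ht' v).symm)⟩

theorem leaderAt_of_mem_goodSet (hc : G.Connected) (hb : ¬ G.IsBipartite) (pick : PortChoice)
    {ω : Outcomes G (Fintype.card V) (mixingTime G)} (hω : ω ∈ goodSet ports) {t : ℕ}
    (ht : 128 * (mixingTime G : ℝ) ≤ t) : (algorithmOn G pick).LeaderAt ports ω t := by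
  have : Nonempty V := hc.nonempty
  exact Good.leaderAt pick hω.1 Fintype.card_pos (two_mul_mixingTime_add_one_le hc hb ht)

theorem messages_le_of_mem_goodSet (hc : G.Connected) (hb : ¬ G.IsBipartite) (pick : PortChoice)
    {ω : Outcomes G (Fintype.card V) (mixingTime G)} (hω : ω ∈ goodSet ports) (t : ℕ) :
    ((algorithmOn G pick).messages ports ω t : ℝ) ≤
      128 * (mixingTime G * √(Fintype.card V) * Real.log (Fintype.card V) ^ (3 / 2 : ℝ)) := by
  have h3 : 3 ≤ Fintype.card V := three_le_card_of_not_isBipartite hb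
  have hT : (1 : ℝ) ≤ mixingTime G := by exact_mod_cast mixingTime_pos hc hb
  have hlog := one_lt_log_of_three_le h3
  have hpow : Real.log (Fintype.card V) ^ (3 / 2 : ℝ) =
      Real.log (Fintype.card V) * √(Real.log (Fintype.card V)) := by
    rw [Real.sqrt_eq_rpow, ← Real.rpow_one_add' (by linarith) (by norm_num)]
    norm_num
  calc ((algorithmOn G pick).messages ports ω t : ℝ)
      ≤ 2 * (mixingTime G + 1) * (numCandidates ω * numTokens (Fintype.card V)) := by
        exact_mod_cast messages_le ports pick ω t
    _ ≤ 4 * mixingTime G * (8 * Real.log (Fintype.card V) *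
          (4 * √(Fintype.card V * Real.log (Fintype.card V)))) := by
        exact mul_le_mul (by linarith) (mul_le_mul hω.2 (numTokens_le_four_mul_sqrt h3)
          (by positivity) (by positivity)) (by positivity) (by positivity)
    _ = 128 * (mixingTime G * √(Fintype.card V) * Real.log (Fintype.card V) ^ (3 / 2 : ℝ)) := by
        rw [hpow, Real.sqrt_mul (by positivity)]
        ring

end Main

end Election

theorem theorem2 :
    ∃ c : ℝ, 0 < c ∧ ∃ K : ℝ,
      ∀ (V : Type*) [Fintype V] [DecidableEq V] (G : SimpleGraph V) [DecidableRel G.Adj]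
        (ports : PortNumbering G) (pick : Election.PortChoice),
        G.Connected → ¬ G.IsBipartite →
        (Election.algorithmOn G pick).MessageSizeLE ports (K * Real.log (Fintype.card V)) ∧
        (Election.algorithmOn G pick).HaltsWithin ports (K * mixingTime G) ∧
        1 - (Fintype.card V : ℝ) ^ (-c) ≤
          ((Election.algorithmOn G pick).prob G).real {ω |
            (∀ t : ℕ, K * (mixingTime G : ℝ) ≤ t →
              (Election.algorithmOn G pick).LeaderAt ports ω t) ∧
            (∀ t : ℕ, ((Election.algorithmOn G pick).messages ports ω t : ℝ) ≤
              K * (mixingTime G * Real.sqrt (Fintype.card V) *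
                Real.log (Fintype.card V) ^ (3 / 2 : ℝ)))} := by
  obtain ⟨c, hc0, hgood⟩ := Election.exists_one_sub_rpow_neg_le_measureReal_goodSet
  refine ⟨c, hc0, 128, fun V _ _ G _ ports pick hc hb => ⟨Election.messageSizeLE ports hb pick,
    Election.haltsWithin ports hc hb pick, (hgood V G ports hc hb).trans ?_⟩⟩
  have : NeZero (Fintype.card V) := ⟨by have := three_le_card_of_not_isBipartite hb; omega⟩
  have : ∀ v, NeZero (G.degree v) := fun v => ⟨(degree_pos_of_not_isBipartite hc hb v).ne'⟩
  exact measureReal_mono (μ := Election.outcomeLaw G (Fintype.card V) (mixingTime G)) fun ω hω =>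
    ⟨fun t ht => Election.leaderAt_of_mem_goodSet ports hc hb pick hω ht,
      fun t => Election.messages_le_of_mem_goodSet ports hc hb pick hω t⟩
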